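/- Let $\omega\subset\mathbb{R}^2$ be a nonempty open set of finite area $|\omega|$, let $B_0\in\mathbb{R}\setminus\{0\}$, and let $A=(A_1,A_2):\mathbb{R}^2\to\mathbb{R}^2$ be a continuously differentiable vector potential generating the constant magnetic field $B_0$, i.e. $\partial_1A_2-\partial_2A_1=B_0$ on $\mathbb{R}^2$. Let $H_\omega(A)=(i\nabla+A)^2$ be the magnetic Dirichlet Laplacian on $\omega$, that is, the self-adjoint operator in $L^2(\omega)$ associated with the closure of the quadratic form $u\mapsto\|(i\nabla+A)u\|_{L^2(\omega)}^2$, $u\in C_c^\infty(\omega)$. Then the eigenvalues of $H_\omega(A)$ can be arranged in an infinite nondecreasing sequence $\mu_1(A)\le\mu_2(A)\le\dots$ in which each eigenvalue is repeated according to its (finite) multiplicity, and for every integer $N\ge 0$ $$\sum_{j\le N}\mu_j(A)\ \ge\ \frac{2\pi N^2}{|\omega|}+\frac{B_0^2}{2\pi}\,|\omega|\,m(1-m),$$ where $m:=\left\{\frac{2\pi N}{B_0|\omega|}\right\}\in[0,1)$ is the fractional part of $\frac{2\pi N}{B_0|\omega|}$. -/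

import Mathlib

open MeasureTheory
open scoped ContDiff

/-- The Euclidean plane. -/
abbrev Plane : Type := EuclideanSpace ℝ (Fin 2)

namespace MagneticPlane

/-- The complex Hilbert space `L²(Ω)`. -/
abbrev L2 (Ω : Set Plane) : Type := Lp ℂ 2 (volume.restrict Ω)

/-- The partial derivative `∂ₖ u (x)`. -/
noncomputable def partialDeriv {F : Type*} [NormedAddCommGroup F] [NormedSpace ℝ F]
    (k : Fin 2) (u : Plane → F) (x : Plane) : F :=
  fderiv ℝ u x (EuclideanSpace.single k 1)

/-- The magnetic field `∂₁A₂ - ∂₂A₁` generated by the vector potential `A` (the coordinates are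
numbered `0, 1` here). -/
noncomputable def magneticField (A : Plane → Plane) (x : Plane) : ℝ :=
  partialDeriv 0 (fun y => A y 1) x - partialDeriv 1 (fun y => A y 0) x

/-- The `k`-th component of the magnetic gradient, `((i∇ + A) u)ₖ = i ∂ₖu + Aₖ u`. -/
noncomputable def magneticGradient (A : Plane → Plane) (k : Fin 2) (u : Plane → ℂ)
    (x : Plane) : ℂ :=
  Complex.I * partialDeriv k u x + (A x k : ℂ) * u x

/-- `u ∈ C_c^∞(Ω)`. -/
structure IsTestFunction (Ω : Set Plane) (u : Plane → ℂ) : Prop where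
  smooth : ContDiff ℝ ∞ u
  compact : HasCompactSupport u
  subset : tsupport u ⊆ Ω

theorem IsTestFunction.zero (Ω : Set Plane) : IsTestFunction Ω 0 where
  smooth := contDiff_const
  compact := HasCompactSupport.zero
  subset := by simp [tsupport]

theorem IsTestFunction.add {Ω : Set Plane} {u v : Plane → ℂ} (hu : IsTestFunction Ω u)
    (hv : IsTestFunction Ω v) : IsTestFunction Ω (u + v) where
  smooth := hu.smooth.add hv.smooth
  compact := hu.compact.add hv.compact
  subset := (tsupport_add u v).trans (Set.union_subset hu.subset hv.subset)

theorem IsTestFunction.const_smul {Ω : Set Plane} {u : Plane → ℂ} (c : ℂ)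
    (hu : IsTestFunction Ω u) : IsTestFunction Ω (c • u) where
  smooth := hu.smooth.const_smul c
  compact := hu.compact.smul_left (f := fun _ => c)
  subset := (tsupport_smul_subset_right (fun _ => c) u).trans hu.subset

theorem magneticGradient_zero (A : Plane → Plane) (k : Fin 2) (x : Plane) :
    magneticGradient A k 0 x = 0 := by
  simp [magneticGradient, partialDeriv]

theorem magneticGradient_add (A : Plane → Plane) (k : Fin 2) {u v : Plane → ℂ}
    (hu : Differentiable ℝ u) (hv : Differentiable ℝ v) (x : Plane) :
    magneticGradient A k (u + v) x = magneticGradient A k u x + magneticGradient A k v x := by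
  simp only [magneticGradient, partialDeriv, fderiv_add (hu x) (hv x),
    add_apply, Pi.add_apply]
  ring

theorem magneticGradient_smul (A : Plane → Plane) (k : Fin 2) {u : Plane → ℂ} (c : ℂ)
    (hu : Differentiable ℝ u) (x : Plane) :
    magneticGradient A k (c • u) x = c * magneticGradient A k u x := by
  simp only [magneticGradient, partialDeriv, fderiv_const_smul (hu x) c,
    smul_apply, Pi.smul_apply, smul_eq_mul]
  ring

theorem IsTestFunction.differentiable {Ω : Set Plane} {u : Plane → ℂ}
    (hu : IsTestFunction Ω u) : Differentiable ℝ u :=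
  hu.smooth.differentiable (by simp)

/-- The graph `{(u, (i∇ + A) u) : u ∈ C_c^∞(Ω)}` in `L²(Ω) × L²(Ω)²`. -/
noncomputable def testGraph (Ω : Set Plane) (A : Plane → Plane) :
    Submodule ℂ (L2 Ω × (Fin 2 → L2 Ω)) where
  carrier := {p | ∃ u : Plane → ℂ, IsTestFunction Ω u ∧ p.1 =ᵐ[volume.restrict Ω] u ∧
    ∀ k, p.2 k =ᵐ[volume.restrict Ω] magneticGradient A k u}
  zero_mem' := by
    refine ⟨0, IsTestFunction.zero Ω, Lp.coeFn_zero _ _ _, fun k => ?_⟩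
    filter_upwards [Lp.coeFn_zero ℂ 2 (volume.restrict Ω)] with x hx
    rw [magneticGradient_zero]
    exact hx
  add_mem' := by
    rintro p q ⟨u, hu, h1, h2⟩ ⟨v, hv, h3, h4⟩
    refine ⟨u + v, hu.add hv, (Lp.coeFn_add p.1 q.1).trans (h1.add h3), fun k => ?_⟩
    filter_upwards [Lp.coeFn_add (p.2 k) (q.2 k), h2 k, h4 k] with x hx hx2 hx4
    rw [magneticGradient_add A k hu.differentiable hv.differentiable, ← hx2, ← hx4]
    exact hx
  smul_mem' := by
    rintro c p ⟨u, hu, h1, h2⟩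
    refine ⟨c • u, hu.const_smul c, (Lp.coeFn_smul c p.1).trans (h1.const_smul c), fun k => ?_⟩
    filter_upwards [Lp.coeFn_smul c (p.2 k), h2 k] with x hx hx2
    rw [magneticGradient_smul A k c hu.differentiable, ← hx2]
    exact hx

/-- The graph of the closure of `i∇ + A` on `C_c^∞(Ω)`, in `L²(Ω) × L²(Ω)²`. Its first components
are the functions in the form domain of the magnetic Dirichlet Laplacian, and for `(u, g)` in it
the closed quadratic form takes the value `‖(i∇ + A) u‖² = ‖g₁‖² + ‖g₂‖²`. -/
noncomputable def formGraph (Ω : Set Plane) (A : Plane → Plane) :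
    Submodule ℂ (L2 Ω × (Fin 2 → L2 Ω)) :=
  (testGraph Ω A).topologicalClosure

/-- The magnetic Dirichlet Laplacian `H_Ω(A) = (i∇ + A)²`, given by its graph in
`L²(Ω) × L²(Ω)`: it is the operator associated with the closed form `‖(i∇ + A) u‖²`, that is,
`H u = f` if and only if `u` is in the form domain and
`⟨(i∇ + A) v, (i∇ + A) u⟩ = ⟨v, f⟩` for all `v` in the form domain. -/
noncomputable def dirichletLaplacian (Ω : Set Plane) (A : Plane → Plane) : Submodule ℂ (L2 Ω × L2 Ω) where
  carrier := {p | ∃ g : Fin 2 → L2 Ω, (p.1, g) ∈ formGraph Ω A ∧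
    ∀ q ∈ formGraph Ω A, ∑ k, inner ℂ (q.2 k) (g k) = inner ℂ q.1 p.2}
  zero_mem' := ⟨0, (formGraph Ω A).zero_mem, by simp⟩
  add_mem' := by
    rintro p q ⟨g, hg, h1⟩ ⟨g', hg', h2⟩
    refine ⟨g + g', (formGraph Ω A).add_mem hg hg', fun r hr => ?_⟩
    simp only [Pi.add_apply, Prod.snd_add, inner_add_right, Finset.sum_add_distrib,
      h1 r hr, h2 r hr]
  smul_mem' := by
    rintro c p ⟨g, hg, h1⟩
    refine ⟨c • g, (formGraph Ω A).smul_mem c hg, fun r hr => ?_⟩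
    simp only [Pi.smul_apply, Prod.smul_snd, inner_smul_right, ← Finset.mul_sum, h1 r hr]

/-- The space `{u : H u = t u}` for the operator `H = H_Ω(A)`; the number `t` is an eigenvalue
if it is nonzero, and its dimension is the multiplicity of `t`. -/
noncomputable def eigenspace (Ω : Set Plane) (A : Plane → Plane) (t : ℝ) : Submodule ℂ (L2 Ω) :=
  (dirichletLaplacian Ω A).comap (LinearMap.prod LinearMap.id ((t : ℂ) • LinearMap.id))

/-- `μ 0 ≤ μ 1 ≤ …` lists all eigenvalues of `H_Ω(A)` in ascending order, each one repeated
according to its multiplicity. -/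
structure IsEigenvalueSequence (Ω : Set Plane) (A : Plane → Plane) (μ : ℕ → ℝ) : Prop where
  monotone : Monotone μ
  multiplicity : ∀ t : ℝ, Cardinal.mk {j : ℕ // μ j = t} = Module.rank ℂ (eigenspace Ω A t)

end MagneticPlane

/-! Write b = |B₀|. On the whole plane the magnetic operator has the Landau levels (2k + 1)b, with
generalized eigenfunctions F_{k,η} indexed by a level k and a momentum η. For a test function u put
q_k(u) = ∫ |⟨F_{k,η}, u⟩|² dη. Then ‖u‖² = ∑ q_k(u), and ‖(i∇ + A)u‖² = ∑ (2k + 1) b q_k(u).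
Discarding nonnegative terms gives, for every n, (2n + 1) b ‖u‖² ≤ ‖(i∇ + A)u‖² + ∑_{k<n} 2b(n - k)
q_k(u). This involves finitely many levels, each continuous on L²(ω), so it passes from test
functions to the whole form domain.

Each level has a fixed density: ∫ ‖F_{k,η}‖²_{L²(ω)} dη = C := b|ω|/(2π). By Bessel's inequality an
orthonormal family puts total weight at most C into each level (`sum_frameEnergy_le`). Summing over
N orthonormal eigenvectors gives ∑ μ_j ≥ b((2n + 1)N - C n(n + 1)) (`sum_eigenvalue_ge`). With P =
N/C the right side equals bC(P² + (P - n)(1 - (P - n))), and an integer n next to P turns this into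
the claim.

The spectral identity is obtained without spectral theory of the Landau operator. A gauge phase
reduces A to (0, B₀x); Fourier transform in y and Hermite expansion in x give Parseval
(`hasSum_integral_gaugedLandauFn`). The energy is b‖u‖² + ‖au‖² for the lowering operator a, whose
adjoint raises F_k to F_{k+1}, so Parseval for au supplies the weights 2bk
(`energy_ge_of_hasCompactSupport`).

The same inequality yields discreteness: off a finite-dimensional space the first n levels carry
little weight, so the energy dominates nb‖u‖². Hence the form domain embeds compactly for any open
set of finite area, and the compact operator (1 + H)⁻¹ provides the eigenvectors. -/

/-! ### Weights of vectors against a square-integrable family -/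

section FrameEnergy

variable {H : Type*} [NormedAddCommGroup H] [InnerProductSpace ℂ H]

/-- The integral `∫ |⟨Φ η, u⟩|² dη` for a one-parameter family `Φ` of vectors. -/
noncomputable def frameEnergy (Φ : ℝ → H) (u : H) : ℝ := ∫ η, ‖inner ℂ (Φ η) u‖ ^ 2

theorem frameEnergy_nonneg (Φ : ℝ → H) (u : H) : 0 ≤ frameEnergy Φ u :=
  integral_nonneg fun _ => by positivity

theorem sq_norm_inner_le (v u : H) : ‖inner ℂ v u‖ ^ 2 ≤ ‖v‖ ^ 2 * ‖u‖ ^ 2 := by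
  rw [← mul_pow]
  exact pow_le_pow_left₀ (norm_nonneg _) (norm_inner_le_norm v u) 2

omit [InnerProductSpace ℂ H] in
theorem integrable_sq_norm {Φ : ℝ → H} (hΦ : MemLp Φ 2) : Integrable fun η => ‖Φ η‖ ^ 2 :=
  hΦ.integrable_norm_pow (by norm_num)

theorem integrable_sq_norm_inner {Φ : ℝ → H} (hΦ : MemLp Φ 2) (u : H) :
    Integrable fun η => ‖inner ℂ (Φ η) u‖ ^ 2 := by
  refine ((integrable_sq_norm hΦ).mul_const (‖u‖ ^ 2)).mono' ?_ (.of_forall fun η => ?_)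
  · exact (hΦ.1.inner aestronglyMeasurable_const).norm.pow 2
  · rw [Real.norm_of_nonneg (by positivity)]
    exact sq_norm_inner_le _ _

theorem frameEnergy_le {Φ : ℝ → H} (hΦ : MemLp Φ 2) (u : H) :
    frameEnergy Φ u ≤ (∫ η, ‖Φ η‖ ^ 2) * ‖u‖ ^ 2 := by
  rw [frameEnergy, ← integral_mul_const]
  exact integral_mono (integrable_sq_norm_inner hΦ u) ((integrable_sq_norm hΦ).mul_const _)
    fun η => sq_norm_inner_le _ _

/-- Continuity is what lets the frame inequality pass from test functions to the closure of their
graph. -/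
theorem continuous_frameEnergy {Φ : ℝ → H} (hΦ : MemLp Φ 2) : Continuous (frameEnergy Φ) := by
  refine continuous_iff_continuousAt.2 fun u => ?_
  refine continuousAt_of_dominated (bound := fun η => ‖Φ η‖ ^ 2 * (‖u‖ + 1) ^ 2)
    (.of_forall fun v => (integrable_sq_norm_inner hΦ v).1) ?_
    ((integrable_sq_norm hΦ).mul_const _) (.of_forall fun η => by fun_prop)
  filter_upwards [continuous_norm.continuousAt.eventually_lt continuousAt_const
    (show ‖u‖ < ‖u‖ + 1 by linarith)] with v hv
  refine .of_forall fun η => ?_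
  rw [Real.norm_of_nonneg (by positivity)]
  exact (sq_norm_inner_le _ _).trans (by gcongr)

/-- Bessel's inequality for the vector `Φ η`, integrated over η. -/
theorem sum_frameEnergy_le {Φ : ℝ → H} (hΦ : MemLp Φ 2) {ι : Type*} (s : Finset ι) {e : ι → H}
    (he : Orthonormal ℂ e) : ∑ j ∈ s, frameEnergy Φ (e j) ≤ ∫ η, ‖Φ η‖ ^ 2 := by
  simp only [frameEnergy]
  rw [← integral_finsetSum _ fun j _ => integrable_sq_norm_inner hΦ (e j)]
  refine integral_mono (integrable_finsetSum _ fun j _ => integrable_sq_norm_inner hΦ (e j))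
    (integrable_sq_norm hΦ) fun η => ?_
  simpa only [norm_inner_symm] using he.sum_inner_products_le (Φ η) (s := s)

/-- A simple function close to `Φ` in L² takes values in a finite-dimensional space; vectors
orthogonal to that space only see the small difference. -/
theorem exists_finiteDimensional_frameEnergy_le {Φ : ℝ → H} (hΦ : MemLp Φ 2) {ε : ℝ}
    (hε : 0 < ε) : ∃ W : Submodule ℂ H, FiniteDimensional ℂ W ∧
      ∀ v ∈ Wᗮ, frameEnergy Φ v ≤ ε * ‖v‖ ^ 2 := by
  obtain ⟨g, hg, hg2⟩ := hΦ.exists_simpleFunc_eLpNorm_sub_lt (by norm_num)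
    (ε := ENNReal.ofReal (√ε)) (by simpa using Real.sqrt_pos.2 hε)
  refine ⟨Submodule.span ℂ (Set.range g), .span_of_finite ℂ g.finite_range, fun v hv => ?_⟩
  have hd : MemLp (fun η => Φ η - g η) 2 := hΦ.sub hg2
  have h1 : frameEnergy Φ v = frameEnergy (fun η => Φ η - g η) v := by
    refine integral_congr_ae (.of_forall fun η => ?_)
    have : inner ℂ (g η) v = 0 :=
      (Submodule.mem_orthogonal _ v).1 hv _ (Submodule.subset_span ⟨η, rfl⟩)
    simp [this]
  rw [h1]
  refine (frameEnergy_le hd v).trans ?_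
  gcongr
  have h2 := hd.eLpNorm_eq_integral_rpow_norm (by norm_num) (by norm_num)
  have hnn : 0 ≤ ∫ η, ‖Φ η - g η‖ ^ 2 := integral_nonneg fun _ => by positivity
  have h3 : eLpNorm (fun η => Φ η - g η) 2 volume
      = ENNReal.ofReal (√(∫ η, ‖Φ η - g η‖ ^ 2)) := by
    rw [h2, Real.sqrt_eq_rpow]
    norm_num
  have h4 : ENNReal.ofReal (√(∫ η, ‖Φ η - g η‖ ^ 2)) < ENNReal.ofReal (√ε) := h3 ▸ hg
  have := (ENNReal.ofReal_lt_ofReal_iff (Real.sqrt_pos.2 hε)).1 h4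
  exact ((Real.sqrt_lt_sqrt_iff hnn).1 this).le

end FrameEnergy

/-- A bounded operator that is small on subspaces of finite codimension is compact. -/
theorem isCompactOperator_of_small_on_orthogonal {R H : Type*} [NormedAddCommGroup R]
    [InnerProductSpace ℂ R] [CompleteSpace R] [NormedAddCommGroup H] [InnerProductSpace ℂ H]
    [CompleteSpace H] (S : R →L[ℂ] H)
    (hS : ∀ δ : ℝ, 0 < δ → ∃ W : Submodule ℂ H, FiniteDimensional ℂ W ∧
      ∀ g, S g ∈ Wᗮ → ‖S g‖ ≤ δ * ‖g‖) : IsCompactOperator S := by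
  have key : ∀ n : ℕ, ∃ F : R →L[ℂ] H, IsCompactOperator F ∧ ‖F - S‖ ≤ 1 / (n + 1 : ℝ) := by
    intro n
    obtain ⟨W, hW, h⟩ := hS (1 / (n + 1 : ℝ)) (by positivity)
    -- If g is orthogonal to S*W, then S g is orthogonal to W. Thus S is small on Uᗮ, and composing
    -- it with the projection onto U gives a finite-rank approximation.
    set U : Submodule ℂ R := W.map (ContinuousLinearMap.adjoint S).toLinearMap
    have : FiniteDimensional ℂ U := inferInstance
    refine ⟨S ∘L U.starProjection, ?_, ?_⟩
    · have h1 : IsCompactOperator U.orthogonalProjectionOnto :=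
        haveI := FiniteDimensional.proper ℂ U
        isCompactOperator_of_locallyCompactSpace_dom (U.orthogonalProjectionOnto : R →L[ℂ] U)
      exact h1.clm_comp (S ∘L U.subtypeL)
    · refine ContinuousLinearMap.opNorm_le_bound _ (by positivity) fun g => ?_
      have h2 : (S ∘L U.starProjection - S) g = - S (g - U.starProjection g) := by
        simp
      rw [h2, norm_neg]
      have h3 : g - U.starProjection g ∈ Uᗮ := U.sub_starProjection_mem_orthogonal g
      refine (h _ ?_).trans ?_
      · refine (Submodule.mem_orthogonal _ _).2 fun w hw => ?_
        rw [← ContinuousLinearMap.adjoint_inner_left]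
        exact (Submodule.mem_orthogonal _ _).1 h3 _ (Submodule.mem_map_of_mem hw)
      · gcongr
        have h4 : g - U.starProjection g = Uᗮ.starProjection g := by
          rw [Submodule.starProjection_orthogonal_val]
        rw [h4]
        exact Uᗮ.norm_starProjection_apply_le g
  choose F hF hFS using key
  refine isCompactOperator_of_tendsto (l := Filter.atTop) (F := F) ?_ (.of_forall hF)
  rw [tendsto_iff_norm_sub_tendsto_zero]
  exact squeeze_zero (fun _ => norm_nonneg _) hFS tendsto_one_div_add_atTop_nhds_zero_nat

/-! ### Closed forms, their resolvents and the abstract eigenvalue bound -/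

section Form

variable {H : Type*} [NormedAddCommGroup H] [InnerProductSpace ℂ H]

/-- A subspace of `H × H²`, regarded as a subspace of the Hilbert sum of three copies of `H`. -/
noncomputable def hilbertGraph (V : Submodule ℂ (H × (Fin 2 → H))) :
    Submodule ℂ (WithLp 2 (H × PiLp 2 fun _ : Fin 2 => H)) :=
  V.comap (((WithLp.prodContinuousLinearEquiv 2 ℂ H (PiLp 2 fun _ : Fin 2 => H)).trans
    ((ContinuousLinearEquiv.refl ℂ H).prodCongr
      (PiLp.continuousLinearEquiv 2 ℂ fun _ : Fin 2 => H))).toLinearMap)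

theorem isClosed_hilbertGraph {V : Submodule ℂ (H × (Fin 2 → H))}
    (hV : IsClosed (V : Set (H × (Fin 2 → H)))) :
    IsClosed (hilbertGraph V : Set (WithLp 2 (H × PiLp 2 fun _ : Fin 2 => H))) :=
  hV.preimage ((WithLp.prodContinuousLinearEquiv 2 ℂ H (PiLp 2 fun _ : Fin 2 => H)).trans
    ((ContinuousLinearEquiv.refl ℂ H).prodCongr
      (PiLp.continuousLinearEquiv 2 ℂ fun _ : Fin 2 => H))).continuous

/-- The form domain with the inner product of the graph. -/
def FormSpace (V : Submodule ℂ (H × (Fin 2 → H))) : Type _ := hilbertGraph V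

noncomputable instance (V : Submodule ℂ (H × (Fin 2 → H))) : NormedAddCommGroup (FormSpace V) :=
  inferInstanceAs (NormedAddCommGroup (hilbertGraph V))

noncomputable instance (V : Submodule ℂ (H × (Fin 2 → H))) : InnerProductSpace ℂ (FormSpace V) :=
  inferInstanceAs (InnerProductSpace ℂ (hilbertGraph V))

theorem completeSpace_formSpace [CompleteSpace H] {V : Submodule ℂ (H × (Fin 2 → H))}
    (hV : IsClosed (V : Set (H × (Fin 2 → H)))) : CompleteSpace (FormSpace V) :=
  (isClosed_hilbertGraph hV).completeSpace_coe

/-- The function underlying an element of the form domain. -/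
def FormSpace.fn {V : Submodule ℂ (H × (Fin 2 → H))} (x : FormSpace V) : H := x.1.fst

/-- The gradient of an element of the form domain. -/
def FormSpace.grad {V : Submodule ℂ (H × (Fin 2 → H))} (x : FormSpace V) : Fin 2 → H :=
  fun k => x.1.snd k

theorem FormSpace.mem {V : Submodule ℂ (H × (Fin 2 → H))} (x : FormSpace V) :
    (x.fn, x.grad) ∈ V := x.2

/-- The element of the form domain given by a point of the graph. -/
def FormSpace.mk {V : Submodule ℂ (H × (Fin 2 → H))} (p : H × (Fin 2 → H)) (hp : p ∈ V) :
    FormSpace V :=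
  ⟨WithLp.toLp 2 (p.1, WithLp.toLp 2 p.2), hp⟩

theorem FormSpace.inner_eq {V : Submodule ℂ (H × (Fin 2 → H))} (x y : FormSpace V) :
    inner ℂ x y = inner ℂ x.fn y.fn + ∑ k, inner ℂ (x.grad k) (y.grad k) := by
  have : inner ℂ x y = inner ℂ x.1 y.1 := rfl
  rw [this, WithLp.prod_inner_apply, PiLp.inner_apply]
  rfl

theorem FormSpace.norm_sq_eq {V : Submodule ℂ (H × (Fin 2 → H))} (x : FormSpace V) :
    ‖x‖ ^ 2 = ‖x.fn‖ ^ 2 + ∑ k, ‖x.grad k‖ ^ 2 := by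
  have := x.inner_eq x
  simp only [inner_self_eq_norm_sq_to_K] at this
  norm_cast at this

/-- The embedding of the form domain, with the graph norm, into `H`. -/
noncomputable def formEmbedding (V : Submodule ℂ (H × (Fin 2 → H))) : FormSpace V →L[ℂ] H :=
  LinearMap.mkContinuous
    { toFun := FormSpace.fn
      map_add' := fun _ _ => rfl
      map_smul' := fun _ _ => rfl } 1 fun x => by
    rw [one_mul]
    refine le_of_sq_le_sq ?_ (norm_nonneg _)
    rw [x.norm_sq_eq]
    exact le_add_of_nonneg_right (Finset.sum_nonneg fun _ _ => by positivity)

theorem formEmbedding_apply (V : Submodule ℂ (H × (Fin 2 → H))) (x : FormSpace V) :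
    formEmbedding V x = x.fn := rfl

variable [CompleteSpace H] (V : Submodule ℂ (H × (Fin 2 → H)))

/-- `u` satisfies `H u = t u`, where `H` is the operator of the quadratic form with graph `V`. -/
def IsFormEigenvector (V : Submodule ℂ (H × (Fin 2 → H))) (t : ℝ) (u : H) : Prop :=
  ∃ g : Fin 2 → H, (u, g) ∈ V ∧
    ∀ q ∈ V, ∑ k, inner ℂ (q.2 k) (g k) = inner ℂ q.1 ((t : ℂ) • u)

/-- The bounded operator `(1 + H)⁻¹`, where `H` is the operator of the form with graph `V`. -/
noncomputable def formResolvent [CompleteSpace (FormSpace V)] : H →L[ℂ] H :=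
  formEmbedding V ∘L ContinuousLinearMap.adjoint (formEmbedding V)

/-- Adding ⟨v, u⟩ to both sides of the weak equation turns its left side into the inner product of
the form space. With S the embedding, the equation then says that the element (u, g) equals (1 +
t)S*u, and applying S gives the claim. -/
theorem isFormEigenvector_iff [CompleteSpace (FormSpace V)] {t : ℝ} {u : H} :
    IsFormEigenvector V t u ↔ u = ((1 + t : ℝ) : ℂ) • formResolvent V u := by
  set S := formEmbedding V with hS
  constructor
  · rintro ⟨g, hg, h⟩
    let x : FormSpace V := .mk (u, g) hg
    have hx : x = ((1 + t : ℝ) : ℂ) • ContinuousLinearMap.adjoint S u := by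
      refine ext_inner_left ℂ fun q => ?_
      rw [inner_smul_right, ContinuousLinearMap.adjoint_inner_right, FormSpace.inner_eq]
      have := h _ q.mem
      simp only [inner_smul_right] at this
      change inner ℂ q.fn u + ∑ k, inner ℂ (q.grad k) (g k) = _ * inner ℂ q.fn u
      rw [show ∑ k, inner ℂ (q.grad k) (g k) = t * inner ℂ q.fn u from this]
      push_cast
      ring
    have := congrArg S hx
    rw [map_smul] at this
    exact this
  · intro h
    set x := ((1 + t : ℝ) : ℂ) • ContinuousLinearMap.adjoint S u with hx
    have hxu : x.fn = u := by
      have : S x = u := by rw [hx, map_smul]; exact h.symm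
      exact this
    refine ⟨x.grad, ?_, fun q hq => ?_⟩
    · rw [← hxu]
      exact x.mem
    · let y : FormSpace V := .mk q hq
      have h1 : inner ℂ y x = ((1 + t : ℝ) : ℂ) * inner ℂ q.1 u := by
        rw [hx, inner_smul_right, ContinuousLinearMap.adjoint_inner_right]
        rfl
      rw [FormSpace.inner_eq, hxu] at h1
      change inner ℂ q.1 u + ∑ k, inner ℂ (q.2 k) (x.grad k) = _ at h1
      rw [inner_smul_right]
      push_cast at h1
      linear_combination h1

variable {V}

omit [CompleteSpace H] in
-- The weak equation tested with the eigenvector itself.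
theorem IsFormEigenvector.exists_energy {t : ℝ} {u : H} (h : IsFormEigenvector V t u) :
    ∃ g, (u, g) ∈ V ∧ ∑ k, ‖g k‖ ^ 2 = t * ‖u‖ ^ 2 := by
  obtain ⟨g, hg, h⟩ := h
  refine ⟨g, hg, ?_⟩
  have := h _ hg
  simp only [inner_smul_right, inner_self_eq_norm_sq_to_K] at this
  exact Complex.ofReal_injective (by push_cast; exact this)

/-- Summing the one-particle bound over an orthonormal family of eigenvectors. -/
theorem sum_eigenvalue_ge {Φ : ℕ → ℝ → H} (hΦ : ∀ k, MemLp (Φ k) 2) {C b : ℝ} (hb : 0 ≤ b)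
    (hC : ∀ k, ∫ η, ‖Φ k η‖ ^ 2 ≤ C)
    (hkey : ∀ n : ℕ, ∀ p ∈ V, (2 * n + 1) * b * ‖p.1‖ ^ 2 ≤ ∑ k, ‖p.2 k‖ ^ 2 +
      ∑ k ∈ Finset.range n, 2 * b * (n - k : ℝ) * frameEnergy (Φ k) p.1)
    {ι : Type*} (s : Finset ι) {e : ι → H} (he : Orthonormal ℂ e) {τ : ι → ℝ}
    (hτ : ∀ j ∈ s, IsFormEigenvector V (τ j) (e j)) (n : ℕ) :
    b * ((2 * n + 1) * s.card - C * (n * (n + 1))) ≤ ∑ j ∈ s, τ j := by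
  have h1 : ∀ j ∈ s, (2 * n + 1) * b ≤ τ j +
      ∑ k ∈ Finset.range n, 2 * b * (n - k : ℝ) * frameEnergy (Φ k) (e j) := by
    intro j hj
    obtain ⟨g, hg, hgt⟩ := (hτ j hj).exists_energy
    have := hkey n _ hg
    simp only [he.1 j, hgt] at this
    linarith
  have h2 := Finset.sum_le_sum h1
  rw [Finset.sum_add_distrib, Finset.sum_comm, Finset.sum_const, nsmul_eq_mul] at h2
  -- After exchanging the sums, Bessel's inequality bounds the total weight in each level by C.
  have h3 : ∑ k ∈ Finset.range n, ∑ j ∈ s, 2 * b * (n - k : ℝ) * frameEnergy (Φ k) (e j)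
      ≤ ∑ k ∈ Finset.range n, 2 * b * (n - k : ℝ) * C := by
    refine Finset.sum_le_sum fun k hk => ?_
    rw [← Finset.mul_sum]
    have : (k : ℝ) ≤ n := by exact_mod_cast (Finset.mem_range.1 hk).le
    exact mul_le_mul_of_nonneg_left ((sum_frameEnergy_le (hΦ k) s he).trans (hC k))
      (mul_nonneg (by linarith) (by linarith))
  have h4 : ∑ k ∈ Finset.range n, 2 * b * (n - k : ℝ) * C = b * C * (n * (n + 1)) := by
    have : ∑ k ∈ Finset.range n, (k : ℝ) = n * (n - 1) / 2 := by
      clear h1 h2 h3 hkey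
      induction n with
      | zero => simp
      | succ n ih => rw [Finset.sum_range_succ, ih]; push_cast; ring
    rw [← Finset.sum_mul, ← Finset.mul_sum, Finset.sum_sub_distrib, this]
    simp
    ring
  linarith

/-- The form domain embeds compactly. -/
theorem isCompactOperator_formEmbedding [CompleteSpace (FormSpace V)]
    {Φ : ℕ → ℝ → H} (hΦ : ∀ k, MemLp (Φ k) 2) {b : ℝ} (hb : 0 < b)
    (hkey : ∀ n : ℕ, ∀ p ∈ V, (2 * n + 1) * b * ‖p.1‖ ^ 2 ≤ ∑ k, ‖p.2 k‖ ^ 2 +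
      ∑ k ∈ Finset.range n, 2 * b * (n - k : ℝ) * frameEnergy (Φ k) p.1) :
    IsCompactOperator (formEmbedding V) := by
  refine isCompactOperator_of_small_on_orthogonal _ fun δ hδ => ?_
  -- The final estimate is n b ‖u‖² ≤ ‖x‖², so n must satisfy n b δ² ≥ 1.
  obtain ⟨n, hn⟩ := exists_nat_gt (1 / (b * δ ^ 2))
  have hn0 : (0 : ℝ) < n := lt_trans (by positivity) hn
  -- With tolerance 1/(2n) each of the n lower levels costs at most b‖u‖², hence n b ‖u‖² of the
  -- available (2n + 1) b ‖u‖² in all.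
  choose W hWfin hW using fun k : ℕ =>
    exists_finiteDimensional_frameEnergy_le (hΦ k) (ε := 1 / (2 * n)) (by positivity)
  refine ⟨(Finset.range n).sup W, Submodule.finiteDimensional_finset_sup _ _, fun x hx => ?_⟩
  rw [formEmbedding_apply] at hx ⊢
  have h1 := hkey n _ x.mem
  have h2 : ∑ k ∈ Finset.range n, 2 * b * (n - k : ℝ) * frameEnergy (Φ k) x.fn
      ≤ ∑ k ∈ Finset.range n, b * ‖x.fn‖ ^ 2 := by
    refine Finset.sum_le_sum fun k hk => ?_
    have hxk := hW k _ (Submodule.orthogonal_le (Finset.le_sup hk) hx)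
    have hk' : (k : ℝ) ≤ n := by exact_mod_cast (Finset.mem_range.1 hk).le
    calc 2 * b * (n - k : ℝ) * frameEnergy (Φ k) x.fn
        ≤ 2 * b * n * (1 / (2 * n) * ‖x.fn‖ ^ 2) := by
          have h0 := frameEnergy_nonneg (Φ k) x.fn
          gcongr
          linarith [(Nat.cast_nonneg k : (0 : ℝ) ≤ k)]
      _ = b * ‖x.fn‖ ^ 2 := by field_simp
  rw [Finset.sum_const, Finset.card_range, nsmul_eq_mul] at h2
  have h3 := x.norm_sq_eq
  change (2 * n + 1) * b * ‖x.fn‖ ^ 2 ≤ ∑ k, ‖x.grad k‖ ^ 2 + _ at h1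
  have h4 : n * b * ‖x.fn‖ ^ 2 ≤ ‖x‖ ^ 2 := by
    have : 0 ≤ b * ‖x.fn‖ ^ 2 := by positivity
    nlinarith [sq_nonneg ‖x.fn‖]
  have h5 : 1 ≤ n * b * δ ^ 2 := by
    rw [div_lt_iff₀ (by positivity)] at hn
    linarith
  refine le_of_sq_le_sq ?_ (by positivity)
  calc ‖x.fn‖ ^ 2 = 1 * ‖x.fn‖ ^ 2 := (one_mul _).symm
    _ ≤ n * b * δ ^ 2 * ‖x.fn‖ ^ 2 := by gcongr
    _ = δ ^ 2 * (n * b * ‖x.fn‖ ^ 2) := by ring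
    _ ≤ δ ^ 2 * ‖x‖ ^ 2 := by gcongr
    _ = (δ * ‖x‖) ^ 2 := by ring

end Form

/-! ### Enumeration of a locally finite family of reals -/

theorem exists_monotone_enumeration {ι : Type*} [Infinite ι] (f : ι → ℝ)
    (hf : ∀ t : ℝ, {i | f i ≤ t}.Finite) : ∃ e : ℕ ≃ ι, Monotone (f ∘ e) := by
  have hc : Countable ι := by
    rw [← Set.countable_univ_iff]
    have : (Set.univ : Set ι) = ⋃ n : ℕ, {i | f i ≤ n} := by
      ext i
      simpa using exists_nat_ge (f i)
    rw [this]
    exact Set.countable_iUnion fun n => (hf n).countable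
  obtain ⟨c, hc⟩ := exists_injective_nat ι
  -- An arbitrary injection into ℕ breaks ties, so ι becomes linearly ordered with finite initial
  -- segments, hence order isomorphic to ℕ.
  let g : ι → ℝ ×ₗ ℕ := fun i => toLex (f i, c i)
  have hg : Function.Injective g := fun i j h => hc (congrArg (fun p => (ofLex p).2) h)
  let _ : LinearOrder ι := LinearOrder.lift' g hg
  have hle : ∀ {i j : ι}, i ≤ j → f i ≤ f j := fun {i j} h =>
    Prod.Lex.monotone_fst_ofLex (show g i ≤ g j from h)
  have hfin : ∀ i : ι, (Set.Iic i).Finite := fun i => (hf (f i)).subset fun j hj => hle hj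
  let _ : LocallyFiniteOrder ι :=
    LocallyFiniteOrder.ofFiniteIcc fun a b => (hfin b).subset Set.Icc_subset_Iic_self
  have : NoMaxOrder ι := ⟨fun a => by
    by_contra! h
    exact Set.infinite_univ ((hfin a).subset fun x _ => h x)⟩
  obtain ⟨m, hm⟩ : ∃ m : ι, ∀ j, m ≤ j := by
    obtain ⟨a⟩ : Nonempty ι := inferInstance
    obtain ⟨m, hma, hm⟩ := Set.exists_min_image (Set.Iic a) id (hfin a) ⟨a, Set.mem_Iic.2 le_rfl⟩
    exact ⟨m, fun j => (le_total j a).elim (hm j) fun h => le_trans hma h⟩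
  let _ : OrderBot ι := { bot := m, bot_le := hm }
  let _ := LinearLocallyFiniteOrder.succOrder ι
  let _ := LinearLocallyFiniteOrder.predOrder ι
  exact ⟨(orderIsoNatOfLinearSuccPredArch (ι := ι)).symm.toEquiv,
    fun i j h => hle ((orderIsoNatOfLinearSuccPredArch (ι := ι)).symm.monotone h)⟩

/-! ### Existence of the eigenvalue sequence and its lower bound -/

section Spectrum

variable {H : Type} [NormedAddCommGroup H] [InnerProductSpace ℂ H] [CompleteSpace H]
  (V : Submodule ℂ (H × (Fin 2 → H)))

theorem isSymmetric_formResolvent [CompleteSpace (FormSpace V)] :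
    (formResolvent V).toLinearMap.IsSymmetric := fun u v => by
  change inner ℂ (formEmbedding V (ContinuousLinearMap.adjoint (formEmbedding V) u)) v =
    inner ℂ u (formEmbedding V (ContinuousLinearMap.adjoint (formEmbedding V) v))
  rw [← ContinuousLinearMap.adjoint_inner_right (formEmbedding V),
    ← ContinuousLinearMap.adjoint_inner_left (formEmbedding V)]

theorem inner_formResolvent_self [CompleteSpace (FormSpace V)] (u : H) :
    inner ℂ u (formResolvent V u) =
      ((‖ContinuousLinearMap.adjoint (formEmbedding V) u‖ ^ 2 : ℝ) : ℂ) := by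
  change inner ℂ u (formEmbedding V (ContinuousLinearMap.adjoint (formEmbedding V) u)) = _
  rw [← ContinuousLinearMap.adjoint_inner_left, inner_self_eq_norm_sq_to_K]
  push_cast
  rfl

variable {V}

/-- Since the resolvent is S S*, its kernel is that of S*, the orthogonal complement of the form
domain. -/
theorem formResolvent_injective [CompleteSpace (FormSpace V)]
    (hdense : ∀ f, (∀ p ∈ V, inner ℂ p.1 f = 0) → f = 0) {u : H} (hu : formResolvent V u = 0) :
    u = 0 := by
  have h1 := inner_formResolvent_self V u
  rw [hu, inner_zero_right] at h1
  have h2 : ContinuousLinearMap.adjoint (formEmbedding V) u = 0 := by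
    have : ‖ContinuousLinearMap.adjoint (formEmbedding V) u‖ ^ 2 = 0 :=
      Complex.ofReal_injective h1.symm
    simpa using this
  refine hdense u fun p hp => ?_
  have := ContinuousLinearMap.adjoint_inner_right (formEmbedding V) (FormSpace.mk p hp) u
  rw [h2, inner_zero_right] at this
  exact this.symm

/-- Symmetry of the resolvent lets the factor 1 + s or 1 + t be drawn out of ⟨u, v⟩; comparing the
two forces the remaining product to vanish. -/
theorem inner_isFormEigenvector_of_ne [CompleteSpace (FormSpace V)] {s t : ℝ} (hst : s ≠ t)
    {u v : H} (hu : IsFormEigenvector V s u) (hv : IsFormEigenvector V t v) :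
    inner ℂ u v = 0 := by
  rw [isFormEigenvector_iff] at hu hv
  have h1 : inner ℂ u v = ((1 + s : ℝ) : ℂ) * inner ℂ u (formResolvent V v) := by
    conv_lhs => rw [hu]
    rw [inner_smul_left, Complex.conj_ofReal]
    congr 1
    exact isSymmetric_formResolvent V u v
  have h2 : inner ℂ u v = ((1 + t : ℝ) : ℂ) * inner ℂ u (formResolvent V v) := by
    conv_lhs => rw [hv]
    rw [inner_smul_right]
  have h3 : ((s - t : ℝ) : ℂ) * inner ℂ u (formResolvent V v) = 0 := by
    push_cast at h1 h2 ⊢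
    linear_combination h2 - h1
  rcases mul_eq_zero.1 h3 with h | h
  · exact absurd (Complex.ofReal_eq_zero.1 h) (sub_ne_zero.2 hst)
  · rw [h1, h, mul_zero]

/-- An eigenvector of the resolvent for the eigenvalue `z` is an eigenvector of the form for
`1 / z - 1`. -/
theorem exists_isFormEigenvector [CompleteSpace (FormSpace V)]
    (hdense : ∀ f, (∀ p ∈ V, inner ℂ p.1 f = 0) → f = 0) {z : ℂ} {u : H}
    (hu : formResolvent V u = z • u) : ∃ t : ℝ, IsFormEigenvector V t u := by
  by_cases hu0 : u = 0
  · refine ⟨0, (isFormEigenvector_iff V).2 ?_⟩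
    simp [hu0]
  have h1 := inner_formResolvent_self V u
  have hpos : (0 : ℝ) < ‖u‖ ^ 2 := by positivity
  rw [hu, inner_smul_right, inner_self_eq_norm_sq_to_K] at h1
  set r : ℝ := ‖ContinuousLinearMap.adjoint (formEmbedding V) u‖ ^ 2 / ‖u‖ ^ 2
  have hz : z = (r : ℂ) := by
    have : ((‖u‖ ^ 2 : ℝ) : ℂ) ≠ 0 := Complex.ofReal_ne_zero.2 hpos.ne'
    rw [Complex.ofReal_div, eq_div_iff this, ← h1]
    push_cast
    rfl
  have hr : r ≠ 0 := by
    intro h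
    apply hu0
    apply formResolvent_injective hdense
    rw [hu, hz, h]
    simp
  refine ⟨1 / r - 1, (isFormEigenvector_iff V).2 ?_⟩
  rw [hu, hz, smul_smul, ← Complex.ofReal_mul]
  have : (1 + (1 / r - 1)) * r = 1 := by field_simp; ring
  rw [this]
  simp

variable {E : ℝ → Submodule ℂ H} (hE : ∀ t u, u ∈ E t ↔ IsFormEigenvector V t u)

include hE in
theorem orthogonalFamily_isFormEigenvector [CompleteSpace (FormSpace V)] :
    OrthogonalFamily ℂ (fun t => E t) fun t => (E t).subtypeₗᵢ := fun s t hst u v =>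
  inner_isFormEigenvector_of_ne hst ((hE s u).1 u.2) ((hE t v).1 v.2)

include hE in
theorem finiteDimensional_isFormEigenvector [CompleteSpace (FormSpace V)]
    (hS : IsCompactOperator (formEmbedding V)) (t : ℝ) : FiniteDimensional ℂ (E t) := by
  have hT : IsCompactOperator (formResolvent V) := hS.comp_clm _
  -- The value t = -1 corresponds to no eigenvalue of the resolvent: the equation then reads u = 0.
  by_cases ht : 1 + t = 0
  · have : E t = ⊥ := by
      refine (Submodule.eq_bot_iff _).2 fun u hu => ?_
      rw [hE, isFormEigenvector_iff, ht] at hu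
      simpa using hu
    rw [this]
    infer_instance
  · have ht' : ((1 + t : ℝ) : ℂ) ≠ 0 := Complex.ofReal_ne_zero.2 ht
    have := ContinuousLinearMap.finite_dimensional_eigenspace hT (((1 + t : ℝ) : ℂ)⁻¹)
      (inv_ne_zero ht')
    refine Submodule.finiteDimensional_of_le (fun u hu => ?_)
      (S₂ := Module.End.eigenspace (formResolvent V).toLinearMap (((1 + t : ℝ) : ℂ)⁻¹))
    rw [hE, isFormEigenvector_iff] at hu
    rw [Module.End.mem_eigenspace_iff]
    conv_rhs => rw [hu]
    rw [smul_smul, inv_mul_cancel₀ ht', one_smul]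
    rfl

variable {Φ : ℕ → ℝ → H} (hΦ : ∀ k, MemLp (Φ k) 2) {C b : ℝ} (hb : 0 < b)
  (hC : ∀ k, ∫ η, ‖Φ k η‖ ^ 2 ≤ C)
  (hkey : ∀ n : ℕ, ∀ p ∈ V, (2 * n + 1) * b * ‖p.1‖ ^ 2 ≤ ∑ k, ‖p.2 k‖ ^ 2 +
    ∑ k ∈ Finset.range n, 2 * b * (n - k : ℝ) * frameEnergy (Φ k) p.1)
  (hV : IsClosed (V : Set (H × (Fin 2 → H))))

include hE hΦ hb hkey hV in
-- Orthonormal bases of the eigenspaces are put together. In the index type the fibre over t has as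
-- many elements as the multiplicity of t, which makes counting a matter of bijections. The last
-- clause replaces completeness: it reduces orthogonality to all eigenspaces to orthogonality to the
-- family.
theorem exists_orthonormal_eigenvectors :
    (∀ t, FiniteDimensional ℂ (E t)) ∧
    ∃ v : (Σ t : ℝ, Fin (Module.finrank ℂ (E t))) → H, Orthonormal ℂ v ∧
      (∀ i, IsFormEigenvector V i.1 (v i)) ∧
      ∀ x, (∀ i, inner ℂ (v i) x = 0) → ∀ t, ∀ u ∈ E t, inner ℂ u x = 0 := by
  have := completeSpace_formSpace hV
  have hfd := finiteDimensional_isFormEigenvector hE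
    (isCompactOperator_formEmbedding hΦ hb hkey)
  refine ⟨hfd, fun i => (stdOrthonormalBasis ℂ (E i.1) i.2 : H), ?_, fun i => ?_, ?_⟩
  · exact (orthogonalFamily_isFormEigenvector hE).orthonormal_sigma_orthonormal
      fun t => (stdOrthonormalBasis ℂ (E t)).orthonormal
  · exact (hE _ _).1 (stdOrthonormalBasis ℂ (E i.1) i.2).2
  · intro x hx t u hu
    have h1 := (stdOrthonormalBasis ℂ (E t)).sum_repr ⟨u, hu⟩
    have h2 : _ = u := congrArg (Subtype.val) h1
    rw [← h2]
    simp only [AddSubmonoidClass.coe_finsetSum, Submodule.coe_smul, sum_inner, inner_smul_left]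
    exact Finset.sum_eq_zero fun i _ => by rw [hx ⟨t, i⟩, mul_zero]

include hE hΦ hb hC hkey hV in
theorem exists_eigenvalue_sequence
    (hdense : ∀ f, (∀ p ∈ V, inner ℂ p.1 f = 0) → f = 0) (hinf : ¬ FiniteDimensional ℂ H) :
    ∃ μ : ℕ → ℝ, Monotone μ ∧
      ∀ t : ℝ, Cardinal.mk {j : ℕ // μ j = t} = Module.rank ℂ (E t) := by
  have := completeSpace_formSpace hV
  obtain ⟨hfd, v, hv, hvE, hvx⟩ := exists_orthonormal_eigenvectors hE hΦ hb hkey hV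
  have hT : IsCompactOperator (formResolvent V) :=
    (isCompactOperator_formEmbedding hΦ hb hkey).comp_clm _
  -- If there were finitely many eigenvectors, the spectral theorem for the compact resolvent would
  -- make their span all of `H`.
  have hι : Infinite (Σ t : ℝ, Fin (Module.finrank ℂ (E t))) := by
    by_contra hfin
    rw [not_infinite_iff_finite] at hfin
    apply hinf
    have hW : FiniteDimensional ℂ (Submodule.span ℂ (Set.range v)) :=
      .span_of_finite ℂ (Set.finite_range v)
    have hbot : (Submodule.span ℂ (Set.range v))ᗮ = ⊥ := by
      refine (Submodule.eq_bot_iff _).2 fun x hx => ?_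
      have hx' : ∀ i, inner ℂ (v i) x = 0 := fun i =>
        (Submodule.mem_orthogonal _ x).1 hx _ (Submodule.subset_span ⟨i, rfl⟩)
      have := ContinuousLinearMap.orthogonalComplement_iSup_eigenspaces_eq_bot hT
        (isSymmetric_formResolvent V)
      rw [← Submodule.mem_bot ℂ, ← this, ← Submodule.iInf_orthogonal, Submodule.mem_iInf]
      intro z
      refine (Submodule.mem_orthogonal _ x).2 fun u hu => ?_
      obtain ⟨t, ht⟩ := exists_isFormEigenvector hdense (Module.End.mem_eigenspace_iff.1 hu)
      exact hvx x hx' t u ((hE t u).2 ht)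
    rw [Submodule.orthogonal_eq_bot_iff] at hbot
    rw [hbot] at hW
    exact Submodule.topEquiv.finiteDimensional
  -- N eigenvalues below t would give N t ≥ (t + 1) N - b C n(n + 1) once (2n + 1) b ≥ t + 1. This
  -- fails for N > b C n(n + 1).
  have hfin : ∀ t : ℝ, {i : Σ t : ℝ, Fin (Module.finrank ℂ (E t)) | i.1 ≤ t}.Finite := by
    intro t
    by_contra hinf
    obtain ⟨n, hn⟩ := exists_nat_gt ((t + 1) / b)
    obtain ⟨N, hN⟩ := exists_nat_gt (b * C * (n * (n + 1)))
    obtain ⟨s, hs, hsN⟩ := Set.Infinite.exists_subset_card_eq hinf N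
    have h1 := sum_eigenvalue_ge hΦ hb.le hC hkey s hv (fun i _ => hvE i) n
    have h2 : ∑ i ∈ s, i.1 ≤ ∑ i ∈ s, t := Finset.sum_le_sum fun i hi => hs hi
    rw [Finset.sum_const, nsmul_eq_mul] at h2
    rw [hsN] at h1 h2
    rw [div_lt_iff₀ hb] at hn
    have hN0 : (0 : ℝ) ≤ N := Nat.cast_nonneg N
    have hn0 : (0 : ℝ) ≤ n := Nat.cast_nonneg n
    have h3 : (t + 1) * N ≤ (2 * n + 1) * b * N := by
      refine mul_le_mul_of_nonneg_right ?_ hN0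
      nlinarith
    linarith
  obtain ⟨e, he⟩ := exists_monotone_enumeration _ hfin
  refine ⟨_, he, fun t => ?_⟩
  rw [← Module.finrank_eq_rank, ← Cardinal.mk_fin]
  refine Cardinal.mk_congr ?_
  exact (e.subtypeEquiv (p := fun j => (e j).1 = t) (q := fun i => i.1 = t) fun j => Iff.rfl).trans
    (Equiv.sigmaSubtype t)

include hE hΦ hb hC hkey hV in
theorem sum_eigenvalue_sequence_ge {μ : ℕ → ℝ}
    (hμ : ∀ t : ℝ, Cardinal.mk {j : ℕ // μ j = t} = Module.rank ℂ (E t)) (N n : ℕ) :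
    b * ((2 * n + 1) * N - C * (n * (n + 1))) ≤ ∑ j ∈ Finset.range N, μ j := by
  obtain ⟨hfd, v, hv, hvE, -⟩ := exists_orthonormal_eigenvectors hE hΦ hb hkey hV
  have h1 : ∀ t, Nonempty ({j : ℕ // μ j = t} ≃ Fin (Module.finrank ℂ (E t))) := fun t => by
    rw [← Cardinal.eq, hμ, Cardinal.mk_fin, Module.finrank_eq_rank]
  -- Equal cardinality of the fibres matches each index j with an eigenvector for the eigenvalue `μ
  -- j`, whatever the sequence `μ`.
  let e : ℕ ≃ Σ t : ℝ, Fin (Module.finrank ℂ (E t)) :=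
    (Equiv.sigmaFiberEquiv μ).symm.trans (Equiv.sigmaCongrRight fun t => (h1 t).some)
  have h2 := sum_eigenvalue_ge hΦ hb.le hC hkey (Finset.range N) (hv.comp e e.injective)
    (τ := μ) (fun j _ => hvE (e j)) n
  simpa using h2

end Spectrum

/-! ### L² norms and Plancherel's theorem -/

theorem norm_sq_toLp {α : Type*} [MeasurableSpace α] {μ : Measure α} {f : α → ℂ}
    (hf : MemLp f 2 μ) : ‖hf.toLp f‖ ^ 2 = ∫ x, ‖f x‖ ^ 2 ∂μ := by
  rw [Lp.norm_toLp, hf.eLpNorm_eq_integral_rpow_norm (by norm_num) (by norm_num)]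
  have h0 : 0 ≤ ∫ x, ‖f x‖ ^ 2 ∂μ := integral_nonneg fun _ => by positivity
  have h1 : ∫ x, ‖f x‖ ^ (2 : ENNReal).toReal ∂μ = ∫ x, ‖f x‖ ^ 2 ∂μ := by norm_num
  rw [h1, ENNReal.toReal_ofNat, ← one_div, ← Real.sqrt_eq_rpow,
    ENNReal.toReal_ofReal (Real.sqrt_nonneg _), Real.sq_sqrt h0]

section Plancherel

open FourierTransform SchwartzMap

theorem continuous_fourier_of_integrable {g : ℝ → ℂ} (hg : Integrable g) : Continuous (𝓕 g) :=
  VectorFourier.fourierIntegral_continuous Real.continuous_fourierChar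
    (by exact continuous_inner) hg

/-- On `L¹ ∩ L²` the Fourier transform of `L²` is given by the Fourier integral. -/
theorem fourier_toLp_ae_eq {g : ℝ → ℂ} (hg : Integrable g) (hg2 : MemLp g 2) :
    (𝓕 (hg2.toLp g) : Lp ℂ 2 (volume : Measure ℝ)) =ᵐ[volume] 𝓕 g := by
  refine ae_eq_of_integral_contDiff_smul_eq
    ((Lp.memLp _).locallyIntegrable (by norm_num))
    -- Both sides are compared as distributions: a test function is a Schwartz function, and either
    -- transform can be moved onto it.
    (continuous_fourier_of_integrable hg).locallyIntegrable fun φ hφ hφc => ?_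
  have h1 : HasCompactSupport (Complex.ofRealCLM ∘ φ) := hφc.comp_left rfl
  have h2 : ContDiff ℝ ∞ (Complex.ofRealCLM ∘ φ) := by fun_prop
  set ψ : 𝓢(ℝ, ℂ) := h1.toSchwartzMap h2 with hψ
  have hψφ : ∀ x, ψ x = (φ x : ℂ) := fun x => rfl
  have h3 := congrArg (fun T => T ψ) (Lp.fourier_toTemperedDistribution_eq (hg2.toLp g))
  simp only [TemperedDistribution.fourier_apply, Lp.toTemperedDistribution_apply] at h3
  calc ∫ x, φ x • (𝓕 (hg2.toLp g) : Lp ℂ 2 (volume : Measure ℝ)) x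
      = ∫ x, ψ x • (𝓕 (hg2.toLp g) : Lp ℂ 2 (volume : Measure ℝ)) x := by
        simp [hψφ]
    _ = ∫ x, (𝓕 ψ) x • (hg2.toLp g) x := h3.symm
    _ = ∫ x, (𝓕 (ψ : ℝ → ℂ)) x • g x := by
        refine integral_congr_ae ?_
        filter_upwards [hg2.coeFn_toLp] with x hx
        rw [hx, fourier_coe]
    _ = ∫ x, ψ x • 𝓕 g x := by
        simpa using! (VectorFourier.integral_fourierIntegral_smul_eq_flip (L := innerₗ ℝ)
          Real.continuous_fourierChar continuous_inner ψ.integrable hg)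
    _ = ∫ x, φ x • 𝓕 g x := by simp [hψφ]

/-- Plancherel's theorem on `L¹ ∩ L²`. -/
theorem integral_sq_norm_fourier {g : ℝ → ℂ} (hg : Integrable g) (hg2 : MemLp g 2) :
    MemLp (𝓕 g) 2 ∧ ∫ x, ‖𝓕 g x‖ ^ 2 = ∫ x, ‖g x‖ ^ 2 := by
  have h := fourier_toLp_ae_eq hg hg2
  have hm : MemLp (𝓕 g) 2 := (memLp_congr_ae h).1 (Lp.memLp _)
  refine ⟨hm, ?_⟩
  have h1 : hm.toLp (𝓕 g) = 𝓕 (hg2.toLp g) := by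
    rw [← Lp.toLp_coeFn (𝓕 (hg2.toLp g)) (Lp.memLp _)]
    exact (MemLp.toLp_eq_toLp_iff _ _).2 h.symm
  have h2 := Lp.norm_fourier_eq (hg2.toLp g)
  rw [← h1] at h2
  rw [← norm_sq_toLp hm, ← norm_sq_toLp hg2, h2]

end Plancherel

/-! ### Hermite functions: orthonormality, raising relation and bounds -/

section Hermite

open Polynomial

/-- The Hermite polynomials for the weight `exp (-b x²)`. -/
noncomputable def hermitePoly (b : ℝ) : ℕ → ℝ[X]
  | 0 => 1
  | k + 1 => C (2 * b) * X * hermitePoly b k - derivative (hermitePoly b k)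

theorem derivative_hermitePoly_succ (b : ℝ) (k : ℕ) :
    derivative (hermitePoly b (k + 1)) = C (2 * b * (k + 1)) * hermitePoly b k := by
  induction k with
  | zero => simp [hermitePoly]
  | succ k ih =>
    have h1 : derivative (hermitePoly b (k + 1 + 1)) = C (2 * b) * hermitePoly b (k + 1) +
        C (2 * b) * X * derivative (hermitePoly b (k + 1)) -
          derivative (derivative (hermitePoly b (k + 1))) := by
      rw [hermitePoly]
      simp only [derivative_sub, derivative_mul, derivative_C, derivative_X]
      ring
    rw [h1, ih, derivative_mul, derivative_C]
    have h2 : hermitePoly b (k + 1) =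
      C (2 * b) * X * hermitePoly b k - derivative (hermitePoly b k) := rfl
    have h3 : C (2 * b * (((k + 1 : ℕ) : ℝ) + 1)) = C (2 * b) + C (2 * b * (k + 1)) := by
      rw [← C_add]
      push_cast
      congr 1
      ring
    rw [h3]
    linear_combination (-C (2 * b * (k + 1))) * h2

theorem integrable_eval_mul_gaussian {b : ℝ} (hb : 0 < b) (p : ℝ[X]) :
    Integrable fun x : ℝ => p.eval x * Real.exp (-b * x ^ 2) := by
  induction p using Polynomial.induction_on' with
  | add p q hp hq =>
    simp only [eval_add, add_mul]
    exact hp.add hq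
  | monomial n a =>
    have h := integrable_rpow_mul_exp_neg_mul_sq hb
      (s := n) (by linarith [(Nat.cast_nonneg n : (0 : ℝ) ≤ n)])
    simpa only [eval_monomial, Real.rpow_natCast, mul_assoc] using h.const_mul a

theorem hasDerivAt_eval_mul_gaussian (b : ℝ) (p : ℝ[X]) (x : ℝ) :
    HasDerivAt (fun x : ℝ => p.eval x * Real.exp (-b * x ^ 2))
      ((derivative p - C (2 * b) * X * p).eval x * Real.exp (-b * x ^ 2)) x := by
  have h1 : HasDerivAt (fun x : ℝ => Real.exp (-b * x ^ 2))
      (Real.exp (-b * x ^ 2) * (-b * (2 * x))) x := by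
    have := ((hasDerivAt_pow 2 x).const_mul (-b)).exp
    simpa using this
  convert! (p.hasDerivAt x).mul h1 using 1
  simp only [eval_sub, eval_mul, eval_C, eval_X]
  ring

/-- Integration by parts: for the Gaussian weight, q ↦ 2bxq - q' is adjoint to differentiation. -/
theorem integral_mul_raise_gaussian {b : ℝ} (hb : 0 < b) (p q : ℝ[X]) :
    ∫ x : ℝ, (p * (C (2 * b) * X * q - derivative q)).eval x * Real.exp (-b * x ^ 2) =
      ∫ x : ℝ, (derivative p * q).eval x * Real.exp (-b * x ^ 2) := by
  have h1 := integral_eq_zero_of_hasDerivAt_of_integrable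
    (fun x => hasDerivAt_eval_mul_gaussian b (p * q) x)
    (integrable_eval_mul_gaussian hb _) (integrable_eval_mul_gaussian hb _)
  rw [← sub_eq_zero, ← integral_sub (integrable_eval_mul_gaussian hb _)
    (integrable_eval_mul_gaussian hb _), ← neg_eq_zero, ← integral_neg, ← h1]
  refine integral_congr_ae (.of_forall fun x => ?_)
  simp only [derivative_mul, eval_sub, eval_mul, eval_add, eval_C, eval_X]
  ring

/-- The squared norm of the `k`-th Hermite polynomial. -/
noncomputable def hermiteNormSq (b : ℝ) (k : ℕ) : ℝ := (2 * b) ^ k * k.factorial * √(Real.pi / b)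

theorem hermiteNormSq_pos {b : ℝ} (hb : 0 < b) (k : ℕ) : 0 < hermiteNormSq b k := by
  unfold hermiteNormSq
  have := Real.sqrt_pos.2 (div_pos Real.pi_pos hb)
  positivity

theorem hermiteNormSq_succ (b : ℝ) (k : ℕ) :
    hermiteNormSq b (k + 1) = 2 * b * (k + 1) * hermiteNormSq b k := by
  simp only [hermiteNormSq, Nat.factorial_succ]
  push_cast
  ring

/-- The raising operation that produces the second factor is moved onto the first as a derivative,
which lowers both indices by one; induction ends at a Gaussian integral. -/
theorem integral_hermitePoly_mul {b : ℝ} (hb : 0 < b) (j k : ℕ) :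
    ∫ x : ℝ, (hermitePoly b j * hermitePoly b k).eval x * Real.exp (-b * x ^ 2) =
      if j = k then hermiteNormSq b k else 0 := by
  induction k generalizing j with
  | zero =>
    rcases j with - | j
    · simpa [hermitePoly, hermiteNormSq] using integral_gaussian b
    · have := integral_mul_raise_gaussian hb 1 (hermitePoly b j)
      simp only [one_mul, derivative_one, zero_mul, eval_zero, integral_zero] at this
      simp only [Nat.add_eq_zero_iff, one_ne_zero, and_false, if_false]
      rw [show hermitePoly b 0 = 1 from rfl, mul_one]
      exact this
  | succ k ih =>
    rw [show hermitePoly b (k + 1) =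
      C (2 * b) * X * hermitePoly b k - derivative (hermitePoly b k) from rfl,
      integral_mul_raise_gaussian hb]
    rcases j with - | j
    · simp [hermitePoly]
    · rw [derivative_hermitePoly_succ]
      have h1 : ∀ x : ℝ, (C (2 * b * (j + 1)) * hermitePoly b j * hermitePoly b k).eval x *
          Real.exp (-b * x ^ 2) = 2 * b * (j + 1) *
            ((hermitePoly b j * hermitePoly b k).eval x * Real.exp (-b * x ^ 2)) := fun x => by
        simp only [eval_mul, eval_C]
        ring
      simp only [h1]
      rw [integral_const_mul, ih, hermiteNormSq_succ]
      by_cases h : j = k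
      · simp [h]
      · simp [h]

/-- The `L²`-normalized eigenfunctions of the harmonic oscillator `-d²/dx² + b² x²`. -/
noncomputable def hermiteFn (b : ℝ) (k : ℕ) (x : ℝ) : ℝ :=
  (hermitePoly b k).eval x * Real.exp (-(b / 2) * x ^ 2) / √(hermiteNormSq b k)

theorem hermiteFn_mul_hermiteFn (b : ℝ) (j k : ℕ) (x : ℝ) :
    hermiteFn b j x * hermiteFn b k x = (√(hermiteNormSq b j) * √(hermiteNormSq b k))⁻¹ *
      ((hermitePoly b j * hermitePoly b k).eval x * Real.exp (-b * x ^ 2)) := by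
  have : Real.exp (-b * x ^ 2) = Real.exp (-(b / 2) * x ^ 2) * Real.exp (-(b / 2) * x ^ 2) := by
    rw [← Real.exp_add]
    congr 1
    ring
  rw [this, eval_mul, hermiteFn, hermiteFn, mul_inv, div_eq_mul_inv, div_eq_mul_inv]
  ring

theorem continuous_hermiteFn (b : ℝ) (k : ℕ) : Continuous (hermiteFn b k) := by
  unfold hermiteFn
  exact ((hermitePoly b k).continuous.mul (by fun_prop)).div_const _

theorem integrable_hermiteFn_mul {b : ℝ} (hb : 0 < b) (j k : ℕ) :
    Integrable fun x => hermiteFn b j x * hermiteFn b k x := by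
  simp only [hermiteFn_mul_hermiteFn]
  exact (integrable_eval_mul_gaussian hb _).const_mul _

theorem integral_hermiteFn_mul {b : ℝ} (hb : 0 < b) (j k : ℕ) :
    ∫ x, hermiteFn b j x * hermiteFn b k x = if j = k then 1 else 0 := by
  simp only [hermiteFn_mul_hermiteFn]
  rw [integral_const_mul, integral_hermitePoly_mul hb]
  split_ifs with h
  · rw [h, Real.mul_self_sqrt (hermiteNormSq_pos hb k).le,
      inv_mul_cancel₀ (hermiteNormSq_pos hb k).ne']
  · simp

/-- The raising relation `-h' + b x h = √(2b(k+1)) h₊`, as a formula for the derivative. -/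
theorem hasDerivAt_hermiteFn {b : ℝ} (hb : 0 < b) (k : ℕ) (x : ℝ) :
    HasDerivAt (hermiteFn b k)
      (b * x * hermiteFn b k x - √(2 * b * (k + 1)) * hermiteFn b (k + 1) x) x := by
  have h := (hasDerivAt_eval_mul_gaussian (b / 2) (hermitePoly b k) x).div_const
    √(hermiteNormSq b k)
  convert! h using 1
  have hk := Real.sqrt_pos.2 (hermiteNormSq_pos hb k)
  have hk1 : 0 < √(2 * b * (k + 1)) := Real.sqrt_pos.2 (by positivity)
  have h1 : √(hermiteNormSq b (k + 1)) = √(2 * b * (k + 1)) * √(hermiteNormSq b k) := by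
    rw [hermiteNormSq_succ, Real.sqrt_mul (by positivity)]
  rw [hermiteFn, hermiteFn, h1, show hermitePoly b (k + 1) =
      C (2 * b) * X * hermitePoly b k - derivative (hermitePoly b k) from rfl]
  simp only [eval_sub, eval_mul, eval_C, eval_X]
  field_simp
  ring

theorem exists_abs_hermiteFn_le {b : ℝ} (hb : 0 < b) (k : ℕ) :
    ∃ M, ∀ x, |hermiteFn b k x| ≤ M := by
  have h : ∀ p : ℝ[X], ∃ M, ∀ x : ℝ, |p.eval x * Real.exp (-(b / 2) * x ^ 2)| ≤ M := by
    intro p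
    induction p using Polynomial.induction_on' with
    | add p q hp hq =>
      obtain ⟨M, hM⟩ := hp
      obtain ⟨N, hN⟩ := hq
      refine ⟨M + N, fun x => ?_⟩
      rw [eval_add, add_mul]
      exact (abs_add_le _ _).trans (add_le_add (hM x) (hN x))
    | monomial n a =>
      refine ⟨|a| * (n.factorial * Real.exp (1 / (2 * b))), fun x => ?_⟩
      rw [eval_monomial, abs_mul, abs_mul, abs_pow, Real.abs_exp, mul_assoc]
      refine mul_le_mul_of_nonneg_left ?_ (abs_nonneg a)
      -- The power is bounded by an exponential, and the exponent |x| - bx²/2 has maximum 1/(2b) by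
      -- completing the square.
      have h1 := Real.pow_div_factorial_le_exp |x| (abs_nonneg x) n
      rw [div_le_iff₀ (by positivity)] at h1
      calc |x| ^ n * Real.exp (-(b / 2) * x ^ 2)
          ≤ Real.exp |x| * n.factorial * Real.exp (-(b / 2) * x ^ 2) := by gcongr
        _ = n.factorial * Real.exp (|x| + -(b / 2) * x ^ 2) := by rw [Real.exp_add]; ring
        _ ≤ n.factorial * Real.exp (1 / (2 * b)) := by
          gcongr
          rw [← sq_abs x, ← sub_nonneg]
          have : 1 / (2 * b) - (|x| + -(b / 2) * |x| ^ 2) = (b * |x| - 1) ^ 2 / (2 * b) := by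
            field_simp
            ring
          rw [this]
          positivity
  obtain ⟨M, hM⟩ := h (hermitePoly b k)
  refine ⟨M / √(hermiteNormSq b k), fun x => ?_⟩
  rw [hermiteFn, abs_div, abs_of_nonneg (Real.sqrt_nonneg _)]
  gcongr
  exact hM x

end Hermite

/-! ### Completeness of the Hermite functions -/

section HermiteComplete

open Polynomial FourierTransform

theorem memLp_hermiteFn {b : ℝ} (hb : 0 < b) (k : ℕ) :
    MemLp (fun x => (hermiteFn b k x : ℂ)) 2 := by
  have hc : Continuous fun x => (hermiteFn b k x : ℂ) :=
    Complex.continuous_ofReal.comp (continuous_hermiteFn b k)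
  rw [memLp_two_iff_integrable_sq_norm hc.aestronglyMeasurable]
  simpa [sq] using integrable_hermiteFn_mul hb k k

theorem memLp_eval_mul_gaussian {b : ℝ} (hb : 0 < b) (p : ℝ[X]) :
    MemLp (fun x : ℝ => ((p.eval x * Real.exp (-(b / 2) * x ^ 2) : ℝ) : ℂ)) 2 := by
  have hc : Continuous fun x : ℝ => ((p.eval x * Real.exp (-(b / 2) * x ^ 2) : ℝ) : ℂ) :=
    Complex.continuous_ofReal.comp (p.continuous.mul (by fun_prop))
  rw [memLp_two_iff_integrable_sq_norm hc.aestronglyMeasurable]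
  refine (integrable_eval_mul_gaussian hb (p * p)).congr (.of_forall fun x => ?_)
  have : Real.exp (-b * x ^ 2) = Real.exp (-(b / 2) * x ^ 2) * Real.exp (-(b / 2) * x ^ 2) := by
    rw [← Real.exp_add]
    congr 1
    ring
  simp only [Complex.norm_real, Real.norm_eq_abs, sq_abs, this, eval_mul]
  ring

/-- Supplies the dominating function when the Fourier exponential is expanded in powers of x. The
constant in the proof comes from completing a square. -/
theorem memLp_exp_mul_gaussian {b : ℝ} (hb : 0 < b) (c : ℝ) :
    MemLp (fun x : ℝ => Real.exp (c * |x|) * Real.exp (-(b / 2) * x ^ 2)) 2 := by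
  have hc : Continuous fun x : ℝ => Real.exp (c * |x|) * Real.exp (-(b / 2) * x ^ 2) := by
    fun_prop
  rw [memLp_two_iff_integrable_sq_norm hc.aestronglyMeasurable]
  refine ((integrable_exp_neg_mul_sq (half_pos hb)).const_mul
    (Real.exp (2 * c ^ 2 / b))).mono' (hc.norm.pow 2).aestronglyMeasurable
    (.of_forall fun x => ?_)
  rw [← Real.exp_add, ← Real.exp_add, Real.norm_eq_abs, Real.norm_eq_abs, Real.abs_exp, abs_pow,
    Real.abs_exp, ← Real.exp_nat_mul, Real.exp_le_exp, ← sq_abs x, ← sub_nonneg]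
  have : 2 * c ^ 2 / b + -(b / 2) * |x| ^ 2 - ((2 : ℕ) : ℝ) * (c * |x| + -(b / 2) * |x| ^ 2) =
      (b * |x| - 2 * c) ^ 2 / (2 * b) := by
    field_simp
    ring
  rw [this]
  positivity

theorem integral_eval_mul_gaussian_eq_zero {b : ℝ} (hb : 0 < b) {f : ℝ → ℂ} (hf : MemLp f 2)
    (h : ∀ k, ∫ x, (hermiteFn b k x : ℂ) * f x = 0) (p : ℝ[X]) :
    ∫ x, ((p.eval x * Real.exp (-(b / 2) * x ^ 2) : ℝ) : ℂ) * f x = 0 := by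
  set Z : ℝ[X] → Prop := fun p =>
    ∫ x, ((p.eval x * Real.exp (-(b / 2) * x ^ 2) : ℝ) : ℂ) * f x = 0 with hZ
  have hint : ∀ p : ℝ[X], Integrable fun x : ℝ =>
      ((p.eval x * Real.exp (-(b / 2) * x ^ 2) : ℝ) : ℂ) * f x := fun p =>
    (memLp_eval_mul_gaussian hb p).integrable_mul hf
  have hadd : ∀ p q, Z p → Z q → Z (p + q) := by
    intro p q hp hq
    have : ∀ x : ℝ, (((p + q).eval x * Real.exp (-(b / 2) * x ^ 2) : ℝ) : ℂ) * f x =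
        ((p.eval x * Real.exp (-(b / 2) * x ^ 2) : ℝ) : ℂ) * f x +
        ((q.eval x * Real.exp (-(b / 2) * x ^ 2) : ℝ) : ℂ) * f x := fun x => by
      rw [eval_add]; push_cast; ring
    simp only [hZ, this]
    rw [integral_add (hint p) (hint q), hp, hq, add_zero]
  have hmul : ∀ (a : ℝ) p, Z p → Z (C a * p) := by
    intro a p hp
    have : ∀ x : ℝ, (((C a * p).eval x * Real.exp (-(b / 2) * x ^ 2) : ℝ) : ℂ) * f x =
        a * (((p.eval x * Real.exp (-(b / 2) * x ^ 2) : ℝ) : ℂ) * f x) := fun x => by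
      rw [eval_mul, eval_C]; push_cast; ring
    simp only [hZ, this]
    rw [integral_const_mul, hp, mul_zero]
  have hP : ∀ k, Z (hermitePoly b k) := by
    intro k
    have hk := Real.sqrt_pos.2 (hermiteNormSq_pos hb k)
    have : ∀ x : ℝ, (((hermitePoly b k).eval x * Real.exp (-(b / 2) * x ^ 2) : ℝ) : ℂ) * f x =
        √(hermiteNormSq b k) * ((hermiteFn b k x : ℂ) * f x) := fun x => by
      rw [← mul_assoc, ← Complex.ofReal_mul, hermiteFn, mul_div_cancel₀ _ hk.ne']
    simp only [hZ, this]
    rw [integral_const_mul, h, mul_zero]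
  have hX : ∀ n k, Z (X ^ n * hermitePoly b k) := by
    intro n
    induction n with
    | zero => simpa using hP
    | succ n ih =>
      intro k
      have hd : Z (X ^ n * derivative (hermitePoly b k)) := by
        rcases k with - | k
        · simp [hZ, hermitePoly]
        · rw [derivative_hermitePoly_succ, mul_left_comm]
          exact hmul _ _ (ih k)
      -- The recursion gives 2b x H_k = H_{k+1} + H_k', and H_k' is a multiple of H_{k-1}, so
      -- multiplication by x stays within the span.
      have : X ^ (n + 1) * hermitePoly b k = C (1 / (2 * b)) *
          (X ^ n * hermitePoly b (k + 1) + X ^ n * derivative (hermitePoly b k)) := by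
        have h1 : C (1 / (2 * b)) * C (2 * b) = 1 := by
          rw [← C_mul, ← C_1]
          congr 1
          field_simp
        rw [show hermitePoly b (k + 1) =
          C (2 * b) * X * hermitePoly b k - derivative (hermitePoly b k) from rfl]
        linear_combination (-X ^ (n + 1) * hermitePoly b k) * h1
      rw [this]
      exact hmul _ _ (hadd _ _ (ih (k + 1)) hd)
  change Z p
  induction p using Polynomial.induction_on' with
  | add p q hp hq => exact hadd p q hp hq
  | monomial n a =>
    rw [← C_mul_X_pow_eq_monomial]
    refine hmul _ _ ?_
    simpa [hermitePoly] using hX n 0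

/-- A function in `L²(ℝ)` orthogonal to all Hermite functions vanishes. -/
theorem ae_eq_zero_of_integral_hermiteFn_mul {b : ℝ} (hb : 0 < b) {f : ℝ → ℂ} (hf : MemLp f 2)
    (h : ∀ k, ∫ x, (hermiteFn b k x : ℂ) * f x = 0) : f =ᵐ[volume] 0 := by
  have hm := integral_eval_mul_gaussian_eq_zero hb hf h
  set g : ℝ → ℂ := fun x => (Real.exp (-(b / 2) * x ^ 2) : ℂ) * f x with hg
  have hg1 : Integrable g := by
    have := (memLp_eval_mul_gaussian hb 1).integrable_mul hf
    simpa [hg] using! this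
  have hg2 : MemLp g 2 := by
    refine hf.of_le hg1.1 (.of_forall fun x => ?_)
    rw [hg, norm_mul]
    refine mul_le_of_le_one_left (norm_nonneg _) ?_
    rw [Complex.norm_real, Real.norm_eq_abs, Real.abs_exp, Real.exp_le_one_iff]
    nlinarith [sq_nonneg x]
  -- Expanding the exponential writes 𝓕 g as a series in the moments of g, all of which vanish.
  -- Plancherel then gives g = 0.
  have hF : 𝓕 g = 0 := by
    ext ξ
    rw [Real.fourier_real_eq_integral_exp_smul]
    set z : ℂ := -2 * Real.pi * ξ * Complex.I with hz
    have hs := hasSum_integral_of_dominated_convergence (μ := volume)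
      (F := fun (n : ℕ) (x : ℝ) => (z * x) ^ n / n.factorial * g x)
      (f := fun x : ℝ => Complex.exp (z * x) * g x)
      (fun n x => (‖z‖ * |x|) ^ n / n.factorial * ‖g x‖) ?_ ?_ ?_ ?_ ?_
    · have h0 : ∀ n : ℕ, ∫ x : ℝ, (z * x) ^ n / n.factorial * g x = 0 := by
        intro n
        have : ∀ x : ℝ, (z * x) ^ n / n.factorial * g x = z ^ n / n.factorial *
            ((((X ^ n : ℝ[X]).eval x * Real.exp (-(b / 2) * x ^ 2) : ℝ) : ℂ) * f x) := by
          intro x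
          simp only [hg, eval_pow, eval_X]
          push_cast
          ring
        simp only [this]
        rw [integral_const_mul, hm, mul_zero]
      simp only [h0] at hs
      rw [Pi.zero_apply, ← hs.unique hasSum_zero]
      refine integral_congr_ae (.of_forall fun x => ?_)
      simp only [smul_eq_mul, hz]
      congr 2
      push_cast
      ring
    · intro n
      exact (Continuous.aestronglyMeasurable (by fun_prop)).mul hg1.1
    · intro n
      refine .of_forall fun x => ?_
      simp
    · refine .of_forall fun x => ?_
      exact (Real.summable_pow_div_factorial _).mul_right _
    · have : ∀ x : ℝ, ∑' n : ℕ, (‖z‖ * |x|) ^ n / n.factorial * ‖g x‖ =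
          (Real.exp (‖z‖ * |x|) * Real.exp (-(b / 2) * x ^ 2)) * ‖f x‖ := by
        intro x
        have h1 : ∑' n : ℕ, (‖z‖ * |x|) ^ n / n.factorial = Real.exp (‖z‖ * |x|) := by
          rw [Real.exp_eq_exp_ℝ, NormedSpace.exp_eq_tsum_div]
        have h2 : ‖g x‖ = Real.exp (-(b / 2) * x ^ 2) * ‖f x‖ := by
          rw [hg, norm_mul, Complex.norm_real, Real.norm_eq_abs, Real.abs_exp]
        rw [tsum_mul_right, h1, h2, mul_assoc]
      simp only [this]
      exact (memLp_exp_mul_gaussian hb ‖z‖).integrable_mul hf.norm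
    · refine .of_forall fun x => ?_
      have := (NormedSpace.expSeries_div_hasSum_exp (z * x : ℂ)).mul_right (g x)
      rwa [← Complex.exp_eq_exp_ℂ] at this
  have h1 := (integral_sq_norm_fourier hg1 hg2).2
  rw [hF] at h1
  simp only [Pi.zero_apply, norm_zero, ne_eq, OfNat.ofNat_ne_zero, not_false_eq_true, zero_pow,
    integral_zero] at h1
  have h2 := (integral_eq_zero_iff_of_nonneg (fun x => by positivity)
    (hg2.integrable_norm_pow (by norm_num))).1 h1.symm
  filter_upwards [h2] with x hx
  have h3 : g x = 0 := by simpa using hx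
  rcases mul_eq_zero.1 h3 with h4 | h4
  · exact absurd h4 (Complex.ofReal_ne_zero.2 (Real.exp_pos _).ne')
  · exact h4

/-- Parseval's identity for the Hermite functions. -/
theorem hasSum_sq_norm_integral_hermiteFn {b : ℝ} (hb : 0 < b) {f : ℝ → ℂ} (hf : MemLp f 2) :
    HasSum (fun k => ‖∫ x, (hermiteFn b k x : ℂ) * f x‖ ^ 2) (∫ x, ‖f x‖ ^ 2) := by
  set e : ℕ → Lp ℂ 2 (volume : Measure ℝ) := fun k => (memLp_hermiteFn hb k).toLp _ with he
  have hinner : ∀ k (g : Lp ℂ 2 (volume : Measure ℝ)),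
      inner ℂ (e k) g = ∫ x, (hermiteFn b k x : ℂ) * g x := by
    intro k g
    rw [L2.inner_def]
    refine integral_congr_ae ?_
    filter_upwards [(memLp_hermiteFn hb k).coeFn_toLp] with x hx
    rw [he, hx]
    simp [mul_comm]
  have hon : Orthonormal ℂ e := by
    rw [orthonormal_iff_ite]
    intro j k
    rw [hinner]
    have : ∫ x, (hermiteFn b j x : ℂ) * e k x =
        ∫ x, ((hermiteFn b j x * hermiteFn b k x : ℝ) : ℂ) := by
      refine integral_congr_ae ?_
      filter_upwards [(memLp_hermiteFn hb k).coeFn_toLp] with x hx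
      rw [he, hx, Complex.ofReal_mul]
    rw [this, integral_complex_ofReal, integral_hermiteFn_mul hb]
    split_ifs <;> simp
  have hbot : (Submodule.span ℂ (Set.range e))ᗮ = ⊥ := by
    refine (Submodule.eq_bot_iff _).2 fun g hg => ?_
    rw [Lp.eq_zero_iff_ae_eq_zero]
    refine ae_eq_zero_of_integral_hermiteFn_mul hb (Lp.memLp g) fun k => ?_
    rw [← hinner]
    exact (Submodule.mem_orthogonal _ g).1 hg _ (Submodule.subset_span ⟨k, rfl⟩)
  let B := HilbertBasis.mkOfOrthogonalEqBot hon hbot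
  have h1 := B.hasSum_inner_mul_inner (hf.toLp f) (hf.toLp f)
  have h2 : ∀ k, inner ℂ (hf.toLp f) (B k) * inner ℂ (B k) (hf.toLp f) =
      ((‖∫ x, (hermiteFn b k x : ℂ) * f x‖ ^ 2 : ℝ) : ℂ) := by
    intro k
    have h3 : inner ℂ (B k) (hf.toLp f) = ∫ x, (hermiteFn b k x : ℂ) * f x := by
      rw [show B k = e k by simp [B], hinner]
      refine integral_congr_ae ?_
      filter_upwards [hf.coeFn_toLp] with x hx
      rw [hx]
    rw [← inner_conj_symm, h3, mul_comm, Complex.mul_conj, Complex.normSq_eq_norm_sq]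
  simp only [h2] at h1
  rw [inner_self_eq_norm_sq_to_K] at h1
  have h4 : ((‖hf.toLp f‖ : ℝ) : ℂ) ^ 2 = ((∫ x, ‖f x‖ ^ 2 : ℝ) : ℂ) := by
    rw [← norm_sq_toLp hf]
    push_cast
    rfl
  exact Complex.hasSum_ofReal.1 (h4 ▸ h1)

end HermiteComplete

/-! ### Landau functions and their Parseval identity -/

section Landau

open FourierTransform

/-- The generalized eigenfunctions of the Landau Hamiltonian in the gauge `(0, B₀ x)`. -/
noncomputable def landauFn (b c : ℝ) (k : ℕ) (η x y : ℝ) : ℂ :=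
  hermiteFn b k (x - c * η) * Complex.exp (2 * Real.pi * Complex.I * η * y)

theorem norm_landauFn (b c : ℝ) (k : ℕ) (η x y : ℝ) :
    ‖landauFn b c k η x y‖ = |hermiteFn b k (x - c * η)| := by
  have : 2 * Real.pi * Complex.I * η * y = ((2 * Real.pi * η * y : ℝ) : ℂ) * Complex.I := by
    push_cast
    ring
  rw [landauFn, norm_mul, this, Complex.norm_exp_ofReal_mul_I, mul_one, Complex.norm_real,
    Real.norm_eq_abs]

theorem continuous_landauFn (b c : ℝ) (k : ℕ) :
    Continuous fun p : ℝ × ℝ × ℝ => landauFn b c k p.1 p.2.1 p.2.2 := by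
  have := continuous_hermiteFn b k
  unfold landauFn
  fun_prop

theorem conj_landauFn (b c : ℝ) (k : ℕ) (η x y : ℝ) :
    (starRingEnd ℂ) (landauFn b c k η x y) =
      hermiteFn b k (x - c * η) * Complex.exp (((-2 * Real.pi * y * η : ℝ) : ℂ) * Complex.I) := by
  rw [landauFn, map_mul, Complex.conj_ofReal, ← Complex.exp_conj]
  congr 2
  simp only [map_mul, Complex.conj_ofReal, Complex.conj_I, map_ofNat]
  push_cast
  ring

theorem exists_support_bound {w : ℝ × ℝ → ℂ} (hwc : HasCompactSupport w) :
    ∃ R, ∀ x y, w (x, y) ≠ 0 → |x| ≤ R ∧ |y| ≤ R := by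
  obtain ⟨R, hR⟩ := hwc.isCompact.isBounded.exists_norm_le
  refine ⟨R, fun x y h => ?_⟩
  have := hR (x, y) (subset_tsupport w h)
  rw [Prod.norm_def, max_le_iff] at this
  exact this

/-- The partial Fourier transform in the second variable. -/
noncomputable def partialFourier (w : ℝ × ℝ → ℂ) (x η : ℝ) : ℂ := 𝓕 (fun y => w (x, y)) η

theorem partialFourier_eq (w : ℝ × ℝ → ℂ) (x η : ℝ) :
    partialFourier w x η =
      ∫ y : ℝ, Complex.exp (((-2 * Real.pi * y * η : ℝ) : ℂ) * Complex.I) * w (x, y) := by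
  rw [partialFourier, Real.fourier_real_eq_integral_exp_smul]
  rfl

theorem continuous_partialFourier {w : ℝ × ℝ → ℂ} (hw : Continuous w)
    (hwc : HasCompactSupport w) : Continuous fun p : ℝ × ℝ => partialFourier w p.1 p.2 := by
  obtain ⟨R, hR⟩ := exists_support_bound hwc
  obtain ⟨M, hM⟩ := hw.bounded_above_of_compact_support hwc
  simp only [partialFourier_eq]
  refine continuous_of_dominated (bound := (Set.Icc (-R) R).indicator fun _ => M)
    (fun p => ?_) (fun p => .of_forall fun y => ?_) ?_ (.of_forall fun y => by fun_prop)
  · exact Continuous.aestronglyMeasurable (by fun_prop)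
  · rw [norm_mul, Complex.norm_exp_ofReal_mul_I, one_mul]
    by_cases hy : y ∈ Set.Icc (-R) R
    · rw [Set.indicator_of_mem hy]
      exact hM _
    · rw [Set.indicator_of_notMem hy, norm_le_zero_iff]
      by_contra h
      exact hy (abs_le.1 (hR _ _ h).2)
  · exact (integrable_indicator_iff measurableSet_Icc).2 (integrableOn_const (by simp))

theorem continuous_slice {w : ℝ × ℝ → ℂ} (hw : Continuous w) (x : ℝ) :
    Continuous fun y => w (x, y) := by fun_prop

theorem hasCompactSupport_slice {w : ℝ × ℝ → ℂ} (hwc : HasCompactSupport w) (x : ℝ) :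
    HasCompactSupport fun y => w (x, y) := by
  obtain ⟨R, hR⟩ := exists_support_bound hwc
  refine HasCompactSupport.intro (isCompact_Icc (a := -R) (b := R)) fun y hy => ?_
  by_contra h
  exact hy (abs_le.1 (hR _ _ h).2)

theorem hasCompactSupport_partialFourier {w : ℝ × ℝ → ℂ} (hwc : HasCompactSupport w) (η : ℝ) :
    HasCompactSupport fun x => partialFourier w x η := by
  obtain ⟨R, hR⟩ := exists_support_bound hwc
  refine HasCompactSupport.intro (isCompact_Icc (a := -R) (b := R)) fun x hx => ?_
  rw [partialFourier_eq]
  have : ∀ y, w (x, y) = 0 := fun y => by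
    by_contra h
    exact hx (abs_le.1 (hR _ _ h).1)
  simp [this]

theorem memLp_partialFourier {w : ℝ × ℝ → ℂ} (hw : Continuous w) (hwc : HasCompactSupport w)
    (η : ℝ) : MemLp (fun x => partialFourier w x η) 2 :=
  Continuous.memLp_of_hasCompactSupport
    ((continuous_partialFourier hw hwc).comp (Continuous.prodMk_left η))
    (hasCompactSupport_partialFourier hwc η)

/-- Integrating over y first produces the partial Fourier transform; translating x by cη centres the
Hermite function. The coefficient is thus a one-dimensional Hermite coefficient for each η. -/
theorem integral_conj_landauFn_mul {w : ℝ × ℝ → ℂ} (hw : Continuous w)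
    (hwc : HasCompactSupport w) (b c : ℝ) (k : ℕ) (η : ℝ) :
    ∫ p : ℝ × ℝ, (starRingEnd ℂ) (landauFn b c k η p.1 p.2) * w p =
      ∫ x, (hermiteFn b k x : ℂ) * partialFourier w (x + c * η) η := by
  have hc : Continuous fun p : ℝ × ℝ => (starRingEnd ℂ) (landauFn b c k η p.1 p.2) * w p :=
    (Complex.continuous_conj.comp ((continuous_landauFn b c k).comp
      (Continuous.prodMk_right η))).mul hw
  rw [Measure.volume_eq_prod, integral_prod _ (by
    rw [← Measure.volume_eq_prod]
    exact hc.integrable_of_hasCompactSupport hwc.mul_left),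
    ← integral_add_right_eq_self _ (c * η)]
  refine integral_congr_ae (.of_forall fun x => ?_)
  simp only [conj_landauFn, add_sub_cancel_right, partialFourier_eq, mul_assoc]
  rw [integral_const_mul]

/-- Plancherel on each vertical line, then Fubini. -/
theorem integral_sq_norm_partialFourier {w : ℝ × ℝ → ℂ} (hw : Continuous w)
    (hwc : HasCompactSupport w) :
    Integrable (fun p : ℝ × ℝ => ‖partialFourier w p.1 p.2‖ ^ 2) (volume.prod volume) ∧
    ∫ p : ℝ × ℝ, ‖partialFourier w p.1 p.2‖ ^ 2 ∂(volume.prod volume) = ∫ p, ‖w p‖ ^ 2 := by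
  have h1 : ∀ x, MemLp (fun η => partialFourier w x η) 2 ∧
      ∫ η, ‖partialFourier w x η‖ ^ 2 = ∫ y, ‖w (x, y)‖ ^ 2 := fun x =>
    integral_sq_norm_fourier
      ((continuous_slice hw x).integrable_of_hasCompactSupport (hasCompactSupport_slice hwc x))
      ((continuous_slice hw x).memLp_of_hasCompactSupport (hasCompactSupport_slice hwc x))
  have h2 : Integrable (fun p : ℝ × ℝ => ‖w p‖ ^ 2) (volume.prod volume) := by
    rw [← Measure.volume_eq_prod]
    exact (hw.memLp_of_hasCompactSupport hwc (p := 2)).integrable_norm_pow (by norm_num)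
  have h3 : Integrable (fun p : ℝ × ℝ => ‖partialFourier w p.1 p.2‖ ^ 2)
      (volume.prod volume) := by
    have hm : Continuous fun p : ℝ × ℝ => ‖partialFourier w p.1 p.2‖ ^ 2 :=
      (continuous_partialFourier hw hwc).norm.pow 2
    rw [integrable_prod_iff hm.aestronglyMeasurable]
    refine ⟨.of_forall fun x => (h1 x).1.integrable_norm_pow (by norm_num), ?_⟩
    refine h2.integral_prod_left.congr (.of_forall fun x => ?_)
    simp only [← (h1 x).2, norm_pow, norm_norm]
  refine ⟨h3, ?_⟩
  rw [integral_prod _ h3, Measure.volume_eq_prod, integral_prod _ h2]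
  exact integral_congr_ae (.of_forall fun x => (h1 x).2)

/-- Parseval's identity for the Landau functions. -/
theorem hasSum_integral_landauFn {b : ℝ} (hb : 0 < b) (c : ℝ) {w : ℝ × ℝ → ℂ} (hw : Continuous w)
    (hwc : HasCompactSupport w) :
    HasSum (fun k => ∫ η, ‖∫ p : ℝ × ℝ, (starRingEnd ℂ) (landauFn b c k η p.1 p.2) * w p‖ ^ 2)
      (∫ p, ‖w p‖ ^ 2) := by
  have hcw := continuous_partialFourier hw hwc
  obtain ⟨h1, h2⟩ := integral_sq_norm_partialFourier hw hwc
  rw [← h2, integral_prod_symm _ h1]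
  simp only [integral_conj_landauFn_mul hw hwc]
  have h3 : ∀ η, HasSum
      (fun k => ‖∫ x, (hermiteFn b k x : ℂ) * partialFourier w (x + c * η) η‖ ^ 2)
      (∫ x, ‖partialFourier w x η‖ ^ 2) := by
    intro η
    rw [← integral_add_right_eq_self (fun x => ‖partialFourier w x η‖ ^ 2) (c * η)]
    exact hasSum_sq_norm_integral_hermiteFn hb
      ((memLp_partialFourier hw hwc η).comp_measurePreserving
        (measurePreserving_add_right volume (c * η)))
  -- The terms are nonnegative, so they serve as their own bounds; their sum is integrable in η by
  -- Fubini.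
  refine hasSum_integral_of_dominated_convergence
    (fun k η => ‖∫ x, (hermiteFn b k x : ℂ) * partialFourier w (x + c * η) η‖ ^ 2)
    (fun k => ?_) (fun k => .of_forall fun η => ?_) (.of_forall fun η => (h3 η).summable) ?_
    (.of_forall h3)
  · have h4 : Continuous fun p : ℝ × ℝ =>
        (hermiteFn b k p.2 : ℂ) * partialFourier w (p.2 + c * p.1) p.1 := by
      have := continuous_hermiteFn b k
      have h5 : Continuous fun p : ℝ × ℝ => partialFourier w (p.2 + c * p.1) p.1 :=
        hcw.comp (f := fun p : ℝ × ℝ => (p.2 + c * p.1, p.1)) (by fun_prop)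
      fun_prop
    exact (h4.stronglyMeasurable.integral_prod_right (ν := volume)).norm.pow 2
      |>.aestronglyMeasurable
  · rw [Real.norm_of_nonneg (by positivity)]
  · simp only [fun η => (h3 η).tsum_eq]
    exact h1.integral_prod_right

end Landau

/-! ### Magnetic gradient: symmetry, commutator and lowering operator -/

section MagneticGradient

open MagneticPlane

theorem partialDeriv_conj (k : Fin 2) {f : Plane → ℂ} {x : Plane} (hf : DifferentiableAt ℝ f x) :
    partialDeriv k (fun y => (starRingEnd ℂ) (f y)) x = (starRingEnd ℂ) (partialDeriv k f x) := by
  have h := (Complex.conjCLE.toContinuousLinearMap.hasFDerivAt (x := f x)).comp x hf.hasFDerivAt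
  have h2 : fderiv ℝ (fun y => (starRingEnd ℂ) (f y)) x =
      Complex.conjCLE.toContinuousLinearMap.comp (fderiv ℝ f x) := h.fderiv
  rw [partialDeriv, h2]
  rfl

theorem continuous_partialDeriv {F : Type*} [NormedAddCommGroup F] [NormedSpace ℝ F] (k : Fin 2)
    {f : Plane → F} (hf : ContDiff ℝ 1 f) : Continuous (partialDeriv k f) :=
  (hf.continuous_fderiv one_ne_zero).clm_apply continuous_const

theorem HasCompactSupport.partialDeriv {F : Type*} [NormedAddCommGroup F] [NormedSpace ℝ F]
    (k : Fin 2) {f : Plane → F} (hf : HasCompactSupport f) :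
    HasCompactSupport (partialDeriv k f) :=
  hf.fderiv_apply (𝕜 := ℝ) _

theorem continuous_coord {A : Plane → Plane} (hA : Continuous A) (k : Fin 2) :
    Continuous fun x => (A x k : ℂ) :=
  Complex.continuous_ofReal.comp ((PiLp.continuous_apply 2 _ k).comp hA)

theorem continuous_magneticGradient {A : Plane → Plane} (hA : Continuous A) (k : Fin 2)
    {f : Plane → ℂ} (hf : ContDiff ℝ 1 f) : Continuous (magneticGradient A k f) :=
  (continuous_const.mul (continuous_partialDeriv k hf)).add
    ((continuous_coord hA k).mul hf.continuous)

theorem HasCompactSupport.magneticGradient (A : Plane → Plane) (k : Fin 2) {f : Plane → ℂ}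
    (hf : HasCompactSupport f) : HasCompactSupport (magneticGradient A k f) :=
  (hf.partialDeriv k).mul_left.add hf.mul_left

/-- The components of the magnetic gradient are symmetric. -/
theorem integral_conj_mul_magneticGradient {A : Plane → Plane} (hA : Continuous A) (k : Fin 2)
    {f g : Plane → ℂ} (hf : ContDiff ℝ 1 f) (hg : ContDiff ℝ 1 g) (hgc : HasCompactSupport g) :
    ∫ x, (starRingEnd ℂ) (f x) * magneticGradient A k g x =
      ∫ x, (starRingEnd ℂ) (magneticGradient A k f x) * g x := by
  have hcf : Continuous fun x => (starRingEnd ℂ) (f x) :=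
    Complex.continuous_conj.comp hf.continuous
  have hcdf : Continuous fun x => (starRingEnd ℂ) (partialDeriv k f x) :=
    Complex.continuous_conj.comp (continuous_partialDeriv k hf)
  have hdf : Differentiable ℝ f := hf.differentiable one_ne_zero
  have hdcf : Differentiable ℝ fun x => (starRingEnd ℂ) (f x) := fun x =>
    (Complex.conjCLE.toContinuousLinearMap.differentiableAt).comp x (hdf x)
  have i1 : Integrable fun x => (starRingEnd ℂ) (partialDeriv k f x) * g x :=
    (hcdf.mul hg.continuous).integrable_of_hasCompactSupport hgc.mul_left
  have i2 : Integrable fun x => (starRingEnd ℂ) (f x) * partialDeriv k g x :=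
    (hcf.mul (continuous_partialDeriv k hg)).integrable_of_hasCompactSupport
      (hgc.partialDeriv k).mul_left
  have i3 : Integrable fun x => (starRingEnd ℂ) (f x) * g x :=
    (hcf.mul hg.continuous).integrable_of_hasCompactSupport hgc.mul_left
  have i4 : Integrable fun x => (A x k : ℂ) * ((starRingEnd ℂ) (f x) * g x) :=
    ((continuous_coord hA k).mul (hcf.mul hg.continuous)).integrable_of_hasCompactSupport
      hgc.mul_left.mul_left
  have key : ∫ x, (starRingEnd ℂ) (f x) * partialDeriv k g x =
      - ∫ x, (starRingEnd ℂ) (partialDeriv k f x) * g x := by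
    have h := integral_mul_fderiv_eq_neg_fderiv_mul_of_integrable (μ := volume)
      (f := fun x => (starRingEnd ℂ) (f x)) (g := g) (v := EuclideanSpace.single k (1 : ℝ))
      (i1.congr (.of_forall fun x => by
        simp only [← partialDeriv_conj k (hdf x)]; rfl)) i2 i3
      (fun x _ => hdcf x) (fun x _ => hg.differentiable one_ne_zero x)
    simp only [← partialDeriv_conj k (hdf _)]
    exact h
  have e1 : ∀ x, (starRingEnd ℂ) (f x) * magneticGradient A k g x =
      Complex.I * ((starRingEnd ℂ) (f x) * partialDeriv k g x) +
        (A x k : ℂ) * ((starRingEnd ℂ) (f x) * g x) := fun x => by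
    rw [magneticGradient]; ring
  have e2 : ∀ x, (starRingEnd ℂ) (magneticGradient A k f x) * g x =
      -Complex.I * ((starRingEnd ℂ) (partialDeriv k f x) * g x) +
        (A x k : ℂ) * ((starRingEnd ℂ) (f x) * g x) := fun x => by
    rw [magneticGradient]
    simp only [map_add, map_mul, Complex.conj_I, Complex.conj_ofReal]
    ring
  simp only [e1, e2]
  rw [integral_add (i2.const_mul _) i4, integral_add (i1.const_mul _) i4, integral_const_mul,
    integral_const_mul, key]
  ring

theorem partialDeriv_comm {u : Plane → ℂ} (hu : ContDiff ℝ 2 u) (j k : Fin 2) (x : Plane) :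
    partialDeriv j (partialDeriv k u) x = partialDeriv k (partialDeriv j u) x := by
  have hd : Differentiable ℝ (fderiv ℝ u) :=
    (hu.fderiv_right (m := 1) (by norm_num)).differentiable one_ne_zero
  have h1 : ∀ j k : Fin 2, partialDeriv j (partialDeriv k u) x =
      fderiv ℝ (fderiv ℝ u) x (EuclideanSpace.single j 1) (EuclideanSpace.single k 1) := by
    intro j k
    have : HasFDerivAt (partialDeriv k u)
        ((ContinuousLinearMap.apply ℝ ℂ (EuclideanSpace.single k (1 : ℝ) : Plane)).comp
          (fderiv ℝ (fderiv ℝ u) x)) x :=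
      HasFDerivAt.comp (g := ContinuousLinearMap.apply ℝ ℂ (EuclideanSpace.single k (1 : ℝ) : Plane))
        x (ContinuousLinearMap.hasFDerivAt _) (hd x).hasFDerivAt
    rw [partialDeriv, this.fderiv]
    rfl
  rw [h1, h1]
  exact (hu.contDiffAt.isSymmSndFDerivAt (by simp)) _ _

theorem contDiff_partialDeriv (k : Fin 2) {u : Plane → ℂ} (hu : ContDiff ℝ 2 u) :
    ContDiff ℝ 1 (partialDeriv k u) :=
  (hu.fderiv_right (m := 1) (by norm_num)).clm_apply contDiff_const

theorem contDiff_coord {A : Plane → Plane} (hA : ContDiff ℝ 1 A) (k : Fin 2) :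
    ContDiff ℝ 1 fun x => A x k :=
  (contDiff_euclidean.1 hA) k

theorem contDiff_magneticGradient {A : Plane → Plane} (hA : ContDiff ℝ 1 A) (k : Fin 2)
    {u : Plane → ℂ} (hu : ContDiff ℝ 2 u) : ContDiff ℝ 1 (magneticGradient A k u) :=
  (contDiff_const.mul (contDiff_partialDeriv k hu)).add
    ((Complex.ofRealCLM.contDiff.comp (contDiff_coord hA k)).mul (hu.of_le (by norm_num)))

theorem partialDeriv_magneticGradient {A : Plane → Plane} (hA : ContDiff ℝ 1 A) (j k : Fin 2)
    {u : Plane → ℂ} (hu : ContDiff ℝ 2 u) (x : Plane) :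
    partialDeriv j (magneticGradient A k u) x =
      Complex.I * partialDeriv j (partialDeriv k u) x +
        ((partialDeriv j (fun y => A y k) x : ℝ) * u x + A x k * partialDeriv j u x) := by
  have h1 := ((contDiff_partialDeriv k hu).differentiable one_ne_zero x).hasFDerivAt
  have h2 := (hu.differentiable (by norm_num) x).hasFDerivAt
  have h3 := (Complex.ofRealCLM.hasFDerivAt (x := A x k)).comp x
    ((contDiff_coord hA k).differentiable one_ne_zero x).hasFDerivAt
  have h4 : HasFDerivAt (magneticGradient A k u) _ x := (h1.const_mul Complex.I).add (h3.mul h2)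
  rw [partialDeriv, h4.fderiv]
  simp [partialDeriv]
  ring

/-- Second derivatives of u cancel by symmetry, and only the derivatives of A survive. -/
theorem magneticGradient_commutator {A : Plane → Plane} (hA : ContDiff ℝ 1 A)
    {u : Plane → ℂ} (hu : ContDiff ℝ 2 u) (x : Plane) :
    magneticGradient A 0 (magneticGradient A 1 u) x -
      magneticGradient A 1 (magneticGradient A 0 u) x =
        Complex.I * (magneticField A x : ℂ) * u x := by
  have h0 : ∀ j k, magneticGradient A j (magneticGradient A k u) x =
      Complex.I * partialDeriv j (magneticGradient A k u) x +
        A x j * (Complex.I * partialDeriv k u x + A x k * u x) := fun j k => rfl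
  rw [h0, h0, partialDeriv_magneticGradient hA 0 1 hu, partialDeriv_magneticGradient hA 1 0 hu,
    partialDeriv_comm hu 0 1, magneticField]
  push_cast
  ring

/-- The lowering operator of the magnetic Hamiltonian. -/
noncomputable def lowering (A : Plane → Plane) (σ : ℝ) (u : Plane → ℂ) (x : Plane) : ℂ :=
  -Complex.I * magneticGradient A 0 u x + σ * magneticGradient A 1 u x

/-- Expanding |au|² leaves a cross term which, after integration by parts, is the commutator paired
with u: iσ · iB₀ ‖u‖² = -b‖u‖². -/
theorem integral_sq_norm_magneticGradient {A : Plane → Plane} (hA : ContDiff ℝ 1 A) {B₀ b σ : ℝ}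
    (hσ : σ ^ 2 = 1) (hb : B₀ = σ * b) (hAB : ∀ x, magneticField A x = B₀)
    {u : Plane → ℂ} (hu : ContDiff ℝ 2 u) (huc : HasCompactSupport u) :
    ∑ k, ∫ x, ‖magneticGradient A k u x‖ ^ 2 =
      (∫ x, ‖lowering A σ u x‖ ^ 2) + b * ∫ x, ‖u x‖ ^ 2 := by
  have hu1 : ContDiff ℝ 1 u := hu.of_le (by norm_num)
  have hc := fun k => continuous_magneticGradient hA.continuous k hu1
  have hs := fun k => huc.magneticGradient A k
  set P : Fin 2 → Plane → ℂ := fun k => magneticGradient A k u with hP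
  have isq : ∀ {f : Plane → ℂ}, Continuous f → HasCompactSupport f →
      Integrable fun x => ‖f x‖ ^ 2 := fun hf hfc =>
    (hf.memLp_of_hasCompactSupport hfc (p := 2)).integrable_norm_pow (by norm_num)
  have hcu : Continuous fun x => (starRingEnd ℂ) (u x) :=
    Complex.continuous_conj.comp hu1.continuous
  have hcP : ∀ k, Continuous fun x => (starRingEnd ℂ) (P k x) := fun k =>
    Complex.continuous_conj.comp (hc k)
  have j1 : ∀ j k, Integrable fun x => (starRingEnd ℂ) (P j x) * P k x := fun j k =>
    ((hcP j).mul (hc k)).integrable_of_hasCompactSupport (hs k).mul_left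
  have j2 : ∀ j k, Integrable fun x => (starRingEnd ℂ) (u x) * magneticGradient A j (P k) x :=
    fun j k => (hcu.mul (continuous_magneticGradient hA.continuous j
      (contDiff_magneticGradient hA k hu))).integrable_of_hasCompactSupport
        ((hs k).magneticGradient A j).mul_left
  have hsymm : ∀ j k, ∫ x, (starRingEnd ℂ) (P j x) * P k x =
      ∫ x, (starRingEnd ℂ) (u x) * magneticGradient A j (P k) x := fun j k =>
    (integral_conj_mul_magneticGradient hA.continuous j hu1
      (contDiff_magneticGradient hA k hu) (hs k)).symm
  have hcomm : (∫ x, (starRingEnd ℂ) (P 0 x) * P 1 x) - ∫ x, (starRingEnd ℂ) (P 1 x) * P 0 x =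
      Complex.I * B₀ * ((∫ x, ‖u x‖ ^ 2 : ℝ) : ℂ) := by
    rw [hsymm, hsymm, ← integral_sub (j2 0 1) (j2 1 0), ← integral_complex_ofReal,
      ← integral_const_mul]
    refine integral_congr_ae (.of_forall fun x => ?_)
    have := magneticGradient_commutator hA hu x
    simp only [← mul_sub]
    rw [hP, this, hAB, Complex.ofReal_pow, ← Complex.conj_mul']
    ring
  have hpt : ∀ x, ((‖lowering A σ u x‖ ^ 2 : ℝ) : ℂ) =
      (((‖P 0 x‖ ^ 2 : ℝ) : ℂ) + ((‖P 1 x‖ ^ 2 : ℝ) : ℂ)) + Complex.I * σ *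
        ((starRingEnd ℂ) (P 0 x) * P 1 x - (starRingEnd ℂ) (P 1 x) * P 0 x) := by
    intro x
    have hσ' : (σ : ℂ) ^ 2 = 1 := by exact_mod_cast hσ
    simp only [Complex.ofReal_pow, ← Complex.conj_mul']
    rw [lowering]
    simp only [map_add, map_mul, map_neg, Complex.conj_I, Complex.conj_ofReal]
    change (_ * (starRingEnd ℂ) (P 0 x) + _ * (starRingEnd ℂ) (P 1 x)) * (_ * P 0 x + _ * P 1 x) = _
    linear_combination ((starRingEnd ℂ) (P 1 x) * P 1 x) * hσ' -
      ((starRingEnd ℂ) (P 0 x) * P 0 x) * Complex.I_sq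
  have hint : ((∫ x, ‖lowering A σ u x‖ ^ 2 : ℝ) : ℂ) =
      ((∫ x, ‖P 0 x‖ ^ 2 : ℝ) : ℂ) + ((∫ x, ‖P 1 x‖ ^ 2 : ℝ) : ℂ) +
        Complex.I * σ * (Complex.I * B₀ * ((∫ x, ‖u x‖ ^ 2 : ℝ) : ℂ)) := by
    rw [← hcomm, ← integral_complex_ofReal]
    simp only [hpt]
    rw [integral_add, integral_add, integral_const_mul, integral_sub (j1 0 1) (j1 1 0),
      integral_complex_ofReal, integral_complex_ofReal]
    · exact (isq (hc 0) (hs 0)).ofReal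
    · exact (isq (hc 1) (hs 1)).ofReal
    · exact (isq (hc 0) (hs 0)).ofReal.add (isq (hc 1) (hs 1)).ofReal
    · exact ((j1 0 1).sub (j1 1 0)).const_mul _
  have hσ' : (σ : ℂ) ^ 2 = 1 := by exact_mod_cast hσ
  rw [Fin.sum_univ_two]
  apply Complex.ofReal_injective
  push_cast at hint ⊢
  rw [hint, hb]
  push_cast
  linear_combination (-(σ : ℂ) ^ 2 * b * ((∫ x, ‖u x‖ ^ 2 : ℝ) : ℂ)) * Complex.I_sq +
    (b * ((∫ x, ‖u x‖ ^ 2 : ℝ) : ℂ)) * hσ'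

end MagneticGradient

/-! ### Reduction to the gauge (0, B₀x) and the raising relation -/

section Gauge

open MagneticPlane

/-- Any two potentials with the same constant field differ by a gradient. -/
theorem exists_gauge {A : Plane → Plane} (hA : ContDiff ℝ 1 A) {B₀ : ℝ}
    (hAB : ∀ x, magneticField A x = B₀) :
    ∃ φ : Plane → ℝ, ContDiff ℝ 1 φ ∧ ∀ x, partialDeriv 0 φ x = A x 0 ∧
      partialDeriv 1 φ x = A x 1 - B₀ * x 0 := by
  let p : Fin 2 → Plane →L[ℝ] ℝ := fun k => EuclideanSpace.proj k
  -- The 1-form of A - (0, B₀x) is closed because both potentials have the same field; the Poincaré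
  -- lemma on the plane gives its primitive.
  let α : Plane → Plane →L[ℝ] ℝ := fun x => A x 0 • p 0 + (A x 1 - B₀ * p 0 x) • p 1
  have hAk := fun k => contDiff_coord hA k
  have hα : ContDiff ℝ 1 α :=
    ((hAk 0).smul contDiff_const).add (((hAk 1).sub
      (contDiff_const.mul (p 0).contDiff)).smul contDiff_const)
  have hd : ∀ x v w, fderiv ℝ α x v w = fderiv ℝ (fun y => A y 0) x v * w 0 +
      (fderiv ℝ (fun y => A y 1) x v - B₀ * v 0) * w 1 := by
    intro x v w
    have h0 := ((hAk 0).differentiable one_ne_zero x).hasFDerivAt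
    have h1 := ((hAk 1).differentiable one_ne_zero x).hasFDerivAt
    have h2 : HasFDerivAt α _ x := (h0.smul_const (p 0)).add
      ((h1.sub ((p 0).hasFDerivAt.const_mul B₀)).smul_const (p 1))
    rw [h2.fderiv]
    simp [p]
  have hexp : ∀ (v : Plane), v = v 0 • EuclideanSpace.single (0 : Fin 2) (1 : ℝ) +
      v 1 • EuclideanSpace.single (1 : Fin 2) (1 : ℝ) := by
    intro v
    ext i
    fin_cases i <;> simp
  have hlin : ∀ (L : Plane →L[ℝ] ℝ) (v : Plane), L v = v 0 * L (EuclideanSpace.single 0 1) +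
      v 1 * L (EuclideanSpace.single 1 1) := by
    intro L v
    conv_lhs => rw [hexp v]
    simp
  obtain ⟨φ, hφ⟩ := convex_univ.exists_forall_hasFDerivAt_of_fderiv_symmetric isOpen_univ
    (hα.differentiable one_ne_zero).differentiableOn (fun x _ v w => by
      have hB := hAB x
      rw [magneticField, partialDeriv, partialDeriv] at hB
      rw [hd, hd, hlin (fderiv ℝ (fun y => A y 0) x) v, hlin (fderiv ℝ (fun y => A y 0) x) w,
        hlin (fderiv ℝ (fun y => A y 1) x) v, hlin (fderiv ℝ (fun y => A y 1) x) w]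
      linear_combination (v 0 * w 1 - w 0 * v 1) * hB)
  have hφ' : fderiv ℝ φ = α := funext fun x => (hφ x trivial).fderiv
  refine ⟨φ, contDiff_one_iff_fderiv.2 ⟨fun x => (hφ x trivial).differentiableAt, ?_⟩,
    fun x => ⟨?_, ?_⟩⟩
  · rw [hφ']
    exact hα.continuous
  · rw [partialDeriv, hφ']
    simp [α, p]
  · rw [partialDeriv, hφ']
    simp [α, p]

/-- The Landau functions for the potential with gauge function `φ`. -/
noncomputable def gaugedLandauFn (φ : Plane → ℝ) (b c : ℝ) (k : ℕ) (η : ℝ) (x : Plane) : ℂ :=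
  Complex.exp (φ x * Complex.I) * landauFn b c k η (x 0) (x 1)

theorem norm_gaugedLandauFn (φ : Plane → ℝ) (b c : ℝ) (k : ℕ) (η : ℝ) (x : Plane) :
    ‖gaugedLandauFn φ b c k η x‖ = |hermiteFn b k (x 0 - c * η)| := by
  rw [gaugedLandauFn, norm_mul, Complex.norm_exp_ofReal_mul_I, one_mul, norm_landauFn]

theorem contDiff_hermiteFn (b : ℝ) (k : ℕ) : ContDiff ℝ 1 (hermiteFn b k) := by
  unfold hermiteFn
  exact ((hermitePoly b k).contDiff_aeval 1 |>.mul (by fun_prop)).div_const _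

theorem contDiff_gaugedLandauFn {φ : Plane → ℝ} (hφ : ContDiff ℝ 1 φ) (b c : ℝ) (k : ℕ) (η : ℝ) :
    ContDiff ℝ 1 (gaugedLandauFn φ b c k η) := by
  have h0 : ∀ i : Fin 2, ContDiff ℝ 1 fun x : Plane => x i := fun i =>
    (EuclideanSpace.proj i : Plane →L[ℝ] ℝ).contDiff
  have hof : ∀ {f : Plane → ℝ}, ContDiff ℝ 1 f → ContDiff ℝ 1 fun x => (f x : ℂ) := fun hf =>
    Complex.ofRealCLM.contDiff.comp hf
  have h1 : ContDiff ℝ 1 fun x : Plane => hermiteFn b k (x 0 - c * η) :=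
    (contDiff_hermiteFn b k).comp ((h0 0).sub contDiff_const)
  exact (((hof hφ).mul contDiff_const).cexp).mul
    ((hof h1).mul ((contDiff_const.mul (hof (h0 1))).cexp))

theorem partialDeriv_gaugedLandauFn {φ : Plane → ℝ} (hφ : ContDiff ℝ 1 φ) {b : ℝ} (hb : 0 < b)
    (c : ℝ) (k : ℕ) (η : ℝ) (x : Plane) (j : Fin 2) :
    partialDeriv j (gaugedLandauFn φ b c k η) x =
      (partialDeriv j φ x * Complex.I + (if j = 1 then 2 * Real.pi * Complex.I * η else 0)) *
          gaugedLandauFn φ b c k η x +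
        (if j = 0 then (b * (x 0 - c * η) * gaugedLandauFn φ b c k η x -
          √(2 * b * (k + 1)) * gaugedLandauFn φ b c (k + 1) η x) else 0) := by
  have h0 : ∀ i : Fin 2, HasFDerivAt (fun x : Plane => x i)
      (EuclideanSpace.proj i : Plane →L[ℝ] ℝ) x := fun i =>
    (EuclideanSpace.proj i : Plane →L[ℝ] ℝ).hasFDerivAt
  have hof : ∀ {f : Plane → ℝ} {f' : Plane →L[ℝ] ℝ}, HasFDerivAt f f' x →
      HasFDerivAt (fun x => (f x : ℂ)) (Complex.ofRealCLM.comp f') x := fun hf =>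
    HasFDerivAt.comp (g := Complex.ofRealCLM) x (ContinuousLinearMap.hasFDerivAt _) hf
  have h1 := hof (HasDerivAt.comp_hasFDerivAt x (hasDerivAt_hermiteFn hb k (x 0 - c * η))
    ((h0 0).sub_const (c * η)))
  have h2 := ((hof (hφ.differentiable one_ne_zero x).hasFDerivAt).mul_const Complex.I).cexp
  have h3 := ((hof (h0 1)).const_mul (2 * Real.pi * Complex.I * η)).cexp
  have h4 : HasFDerivAt (gaugedLandauFn φ b c k η) _ x := h2.mul (h1.mul h3)
  rw [partialDeriv, h4.fderiv]
  fin_cases j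
  · simp [gaugedLandauFn, landauFn, partialDeriv]
    ring
  · simp [gaugedLandauFn, landauFn, partialDeriv]
    ring

/-- The raising operator maps each Landau level to the next one. -/
theorem raising_gaugedLandauFn {A : Plane → Plane} {φ : Plane → ℝ} (hφ : ContDiff ℝ 1 φ)
    {B₀ b σ : ℝ} (hb : 0 < b) (hσ : σ ^ 2 = 1) (hB : B₀ = σ * b)
    (h0 : ∀ x, partialDeriv 0 φ x = A x 0) (h1 : ∀ x, partialDeriv 1 φ x = A x 1 - B₀ * x 0)
    (k : ℕ) (η : ℝ) (x : Plane) :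
    Complex.I * magneticGradient A 0 (gaugedLandauFn φ b (2 * Real.pi * σ / b) k η) x +
      σ * magneticGradient A 1 (gaugedLandauFn φ b (2 * Real.pi * σ / b) k η) x =
    √(2 * b * (k + 1)) * gaugedLandauFn φ b (2 * Real.pi * σ / b) (k + 1) η x := by
  rw [magneticGradient, magneticGradient, partialDeriv_gaugedLandauFn hφ hb,
    partialDeriv_gaugedLandauFn hφ hb, h0, h1, hB]
  simp only [if_true, Fin.isValue, zero_ne_one, one_ne_zero, if_false]
  set G := gaugedLandauFn φ b (2 * Real.pi * σ / b) k η x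
  set G' := gaugedLandauFn φ b (2 * Real.pi * σ / b) (k + 1) η x
  have hbc : (b : ℂ) ≠ 0 := Complex.ofReal_ne_zero.2 hb.ne'
  have hσ' : (σ : ℂ) ^ 2 = 1 := by exact_mod_cast hσ
  -- The shift c = 2πσ/b is chosen for this: it makes σ(B₀x - 2πη) equal to b(x - cη), which cancels
  -- the corresponding term of the Hermite derivative.
  have hc : (b : ℂ) * ((2 * Real.pi * σ / b : ℝ) : ℂ) = 2 * Real.pi * σ := by
    push_cast
    field_simp
  push_cast at hc ⊢
  set c : ℂ := 2 * Real.pi * σ / b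
  linear_combination (A x 0 * Complex.I * G + b * (x 0 - c * η) * G - √(2 * b * (k + 1)) * G' +
    σ * ((A x 1 - σ * b * x 0) + 2 * Real.pi * η) * G) * Complex.I_sq + (b * x 0 * G) * hσ' +
    (η * G) * hc

/-- The lowering operator is moved onto the Landau function by symmetry of the magnetic gradient,
where its adjoint raises the level. -/
theorem integral_conj_gaugedLandauFn_mul_lowering {A : Plane → Plane} (hA : Continuous A)
    {φ : Plane → ℝ} (hφ : ContDiff ℝ 1 φ) {B₀ b σ : ℝ} (hb : 0 < b) (hσ : σ ^ 2 = 1)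
    (hB : B₀ = σ * b) (h0 : ∀ x, partialDeriv 0 φ x = A x 0)
    (h1 : ∀ x, partialDeriv 1 φ x = A x 1 - B₀ * x 0) (k : ℕ) (η : ℝ)
    {u : Plane → ℂ} (hu : ContDiff ℝ 1 u) (huc : HasCompactSupport u) :
    ∫ x, (starRingEnd ℂ) (gaugedLandauFn φ b (2 * Real.pi * σ / b) k η x) * lowering A σ u x =
      √(2 * b * (k + 1)) *
        ∫ x, (starRingEnd ℂ) (gaugedLandauFn φ b (2 * Real.pi * σ / b) (k + 1) η x) * u x := by
  set F := fun k => gaugedLandauFn φ b (2 * Real.pi * σ / b) k η with hF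
  have hFc := fun k => contDiff_gaugedLandauFn hφ b (2 * Real.pi * σ / b) k η
  have i1 : ∀ j, Integrable fun x => (starRingEnd ℂ) (F k x) * magneticGradient A j u x :=
    fun j => ((Complex.continuous_conj.comp (hFc k).continuous).mul
      (continuous_magneticGradient hA j hu)).integrable_of_hasCompactSupport
        (huc.magneticGradient A j).mul_left
  have i2 : ∀ j, Integrable fun x => (starRingEnd ℂ) (magneticGradient A j (F k) x) * u x :=
    fun j => ((Complex.continuous_conj.comp (continuous_magneticGradient hA j (hFc k))).mul
      hu.continuous).integrable_of_hasCompactSupport huc.mul_left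
  have hs := fun j => integral_conj_mul_magneticGradient hA j (hFc k) hu huc
  have e1 : ∀ x, (starRingEnd ℂ) (F k x) * lowering A σ u x =
      -Complex.I * ((starRingEnd ℂ) (F k x) * magneticGradient A 0 u x) +
        σ * ((starRingEnd ℂ) (F k x) * magneticGradient A 1 u x) := fun x => by
    rw [lowering]; ring
  have e2 : ∀ x, √(2 * b * (k + 1)) * ((starRingEnd ℂ) (F (k + 1) x) * u x) =
      -Complex.I * ((starRingEnd ℂ) (magneticGradient A 0 (F k) x) * u x) +
        σ * ((starRingEnd ℂ) (magneticGradient A 1 (F k) x) * u x) := fun x => by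
    have := congrArg (starRingEnd ℂ) (raising_gaugedLandauFn hφ hb hσ hB h0 h1 k η x)
    simp only [map_add, map_mul, Complex.conj_I, Complex.conj_ofReal] at this
    rw [← mul_assoc, ← this]
    ring
  change ∫ x, (starRingEnd ℂ) (F k x) * lowering A σ u x =
    √(2 * b * (k + 1)) * ∫ x, (starRingEnd ℂ) (F (k + 1) x) * u x
  rw [← integral_const_mul]
  simp only [e1, e2]
  rw [integral_add ((i1 0).const_mul _) ((i1 1).const_mul _),
    integral_add ((i2 0).const_mul _) ((i2 1).const_mul _)]
  simp only [integral_const_mul]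
  rw [hs 0, hs 1]

/-- The plane as a product. -/
noncomputable def planeEquiv : Plane ≃L[ℝ] ℝ × ℝ :=
  (PiLp.continuousLinearEquiv 2 ℝ fun _ : Fin 2 => ℝ).trans (ContinuousLinearEquiv.finTwoArrow ℝ ℝ)

theorem planeEquiv_apply (x : Plane) : planeEquiv x = (x 0, x 1) := rfl

theorem measurePreserving_planeEquiv : MeasurePreserving planeEquiv :=
  (volume_preserving_finTwoArrow ℝ).comp (PiLp.volume_preserving_ofLp (Fin 2))

theorem integral_planeEquiv {F : Type*} [NormedAddCommGroup F] [NormedSpace ℝ F]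
    (g : ℝ × ℝ → F) : ∫ x, g (planeEquiv x) = ∫ p, g p :=
  measurePreserving_planeEquiv.integral_comp planeEquiv.toHomeomorph.measurableEmbedding g

theorem hasSum_integral_gaugedLandauFn {φ : Plane → ℝ} (hφ : Continuous φ) {b : ℝ} (hb : 0 < b)
    (c : ℝ) {w : Plane → ℂ} (hw : Continuous w) (hwc : HasCompactSupport w) :
    HasSum (fun k => ∫ η, ‖∫ x, (starRingEnd ℂ) (gaugedLandauFn φ b c k η x) * w x‖ ^ 2)
      (∫ x, ‖w x‖ ^ 2) := by
  -- The gauge phase has modulus one and is absorbed into w.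
  set v : Plane → ℂ := fun x => (starRingEnd ℂ) (Complex.exp (φ x * Complex.I)) * w x with hv
  have hvc : Continuous v := by
    have : Continuous fun x => (starRingEnd ℂ) (Complex.exp (φ x * Complex.I)) :=
      Complex.continuous_conj.comp (by fun_prop)
    exact this.mul hw
  have hvs : HasCompactSupport v := hwc.mul_left
  have hnorm : ∀ x, ‖v x‖ = ‖w x‖ := fun x => by
    rw [hv, norm_mul, RCLike.norm_conj, Complex.norm_exp_ofReal_mul_I, one_mul]
  have h := hasSum_integral_landauFn hb c (hvc.comp planeEquiv.symm.continuous)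
    (hvs.comp_homeomorph planeEquiv.symm.toHomeomorph)
  rw [← integral_planeEquiv] at h
  have hsymm : ∀ x : Plane, planeEquiv.symm (x 0, x 1) = x := planeEquiv.symm_apply_apply
  simp only [← integral_planeEquiv, Function.comp_apply, planeEquiv_apply, hsymm, hnorm] at h
  convert! h using 8
  simp only [gaugedLandauFn, hv, map_mul]
  ring

end Gauge

/-! ### Landau functions restricted to a set of finite area -/

section LandauFrame

open MagneticPlane

theorem integral_sq_hermiteFn_shift {b c : ℝ} (hb : 0 < b) (hc : c ≠ 0) (k : ℕ) (s : ℝ) :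
    Integrable (fun η => hermiteFn b k (s - c * η) ^ 2) ∧
      ∫ η, hermiteFn b k (s - c * η) ^ 2 = |c|⁻¹ := by
  have h1 : Integrable fun y => hermiteFn b k y ^ 2 := by
    simpa only [sq] using integrable_hermiteFn_mul hb k k
  have h2 : ∫ y, hermiteFn b k y ^ 2 = 1 := by
    simpa only [sq, if_true] using integral_hermiteFn_mul hb k k
  refine ⟨(h1.comp_sub_left s).comp_mul_left' hc, ?_⟩
  rw [Measure.integral_comp_mul_left (fun y => hermiteFn b k (s - y) ^ 2) c,
    integral_sub_left_eq_self (fun y => hermiteFn b k y ^ 2) volume s, h2, smul_eq_mul, mul_one,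
    abs_inv]

/-- By Fubini each point of `Ω` contributes ∫ h_k(s - cη)² dη = 1/|c|, independently of k and of the
point. This is the density of states of a Landau level. -/
theorem integral_integral_sq_hermiteFn {Ω : Set Plane} (hfin : volume Ω < ⊤) {b c : ℝ}
    (hb : 0 < b) (hc : c ≠ 0) (k : ℕ) :
    Integrable (fun η => ∫ x in Ω, hermiteFn b k (x 0 - c * η) ^ 2) ∧
      ∫ η, ∫ x in Ω, hermiteFn b k (x 0 - c * η) ^ 2 = volume.real Ω * |c|⁻¹ := by
  have : IsFiniteMeasure (volume.restrict Ω) := ⟨by simpa using hfin⟩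
  have hcont : Continuous fun p : ℝ × Plane => hermiteFn b k (p.2 0 - c * p.1) ^ 2 := by
    have := continuous_hermiteFn b k
    fun_prop
  have h := fun s => integral_sq_hermiteFn_shift hb hc k s
  have hint : Integrable (fun p : ℝ × Plane => hermiteFn b k (p.2 0 - c * p.1) ^ 2)
      (volume.prod (volume.restrict Ω)) := by
    refine (integrable_prod_iff' hcont.aestronglyMeasurable).2
      ⟨Filter.Eventually.of_forall fun x => (h (x 0)).1, ?_⟩
    refine (integrable_const |c|⁻¹).congr (Filter.Eventually.of_forall fun x => ?_)
    simp only [norm_pow, Real.norm_eq_abs, sq_abs]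
    exact (h (x 0)).2.symm
  refine ⟨hint.integral_prod_left, ?_⟩
  calc ∫ η, ∫ x in Ω, hermiteFn b k (x 0 - c * η) ^ 2
      = ∫ x in Ω, ∫ η, hermiteFn b k (x 0 - c * η) ^ 2 := integral_integral_swap hint
    _ = ∫ x in Ω, |c|⁻¹ := integral_congr_ae (.of_forall fun x => (h (x 0)).2)
    _ = volume.real Ω * |c|⁻¹ := by simp

theorem memLp_gaugedLandauFn {Ω : Set Plane} (hfin : volume Ω < ⊤) {φ : Plane → ℝ}
    (hφ : ContDiff ℝ 1 φ) {b : ℝ} (hb : 0 < b) (c : ℝ) (k : ℕ) (η : ℝ) :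
    MemLp (gaugedLandauFn φ b c k η) 2 (volume.restrict Ω) := by
  have : IsFiniteMeasure (volume.restrict Ω) := ⟨by simpa using hfin⟩
  obtain ⟨M, hM⟩ := exists_abs_hermiteFn_le hb k
  refine .of_bound (contDiff_gaugedLandauFn hφ b c k η).continuous.aestronglyMeasurable M
    (.of_forall fun x => ?_)
  rw [norm_gaugedLandauFn]
  exact hM _

theorem continuous_gaugedLandauFn (φ : Plane → ℝ) (b c : ℝ) (k : ℕ)
    (x : Plane) : Continuous fun η => gaugedLandauFn φ b c k η x := by
  unfold gaugedLandauFn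
  exact continuous_const.mul ((continuous_landauFn b c k).comp
    (f := fun η : ℝ => (η, x 0, x 1)) (by fun_prop))

/-- Provides the measurability in η needed for the family to be square integrable with values in L².
-/
theorem continuous_toLp_gaugedLandauFn {Ω : Set Plane} (hfin : volume Ω < ⊤) {φ : Plane → ℝ}
    (hφ : ContDiff ℝ 1 φ) {b : ℝ} (hb : 0 < b) (c : ℝ) (k : ℕ) :
    Continuous fun η => (memLp_gaugedLandauFn hfin hφ hb c k η).toLp _ := by
  have : IsFiniteMeasure (volume.restrict Ω) := ⟨by simpa using hfin⟩
  obtain ⟨M, hM⟩ := exists_abs_hermiteFn_le hb k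
  set F := gaugedLandauFn φ b c k with hF
  have hFM : ∀ η x, ‖F η x‖ ≤ M := fun η x => by
    rw [hF, norm_gaugedLandauFn]
    exact hM _
  have hcF := fun η => (contDiff_gaugedLandauFn hφ b c k η).continuous
  refine continuous_iff_continuousAt.2 fun η₀ => ?_
  have h1 : Continuous fun η => ∫ x in Ω, ‖F η x - F η₀ x‖ ^ 2 := by
    refine continuous_of_dominated (bound := fun _ => (M + M) ^ 2) (fun η => ?_)
      (fun η => .of_forall fun x => ?_) (integrable_const _) (.of_forall fun x => ?_)
    · have : Continuous fun x => ‖F η x - F η₀ x‖ ^ 2 := ((hcF η).sub (hcF η₀)).norm.pow 2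
      exact this.aestronglyMeasurable
    · rw [Real.norm_of_nonneg (by positivity)]
      gcongr
      exact (norm_sub_le _ _).trans (add_le_add (hFM _ _) (hFM _ _))
    · exact ((continuous_gaugedLandauFn φ b c k x).sub continuous_const).norm.pow 2
  rw [ContinuousAt, tendsto_iff_norm_sub_tendsto_zero]
  have h2 : ∀ η, ‖(memLp_gaugedLandauFn hfin hφ hb c k η).toLp (F η) -
      (memLp_gaugedLandauFn hfin hφ hb c k η₀).toLp (F η₀)‖ =
        √(∫ x in Ω, ‖F η x - F η₀ x‖ ^ 2) := by
    intro η
    rw [← MemLp.toLp_sub, ← Real.sqrt_sq (norm_nonneg _), norm_sq_toLp]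
    rfl
  refine Filter.Tendsto.congr (fun η => (h2 η).symm) ?_
  have h3 := (Real.continuous_sqrt.comp h1).tendsto η₀
  simpa [Function.comp_def] using h3

/-- The Landau functions restricted to a set of finite area, as vectors in `L²`. -/
theorem exists_landauFrame {Ω : Set Plane} (hfin : volume Ω < ⊤) {φ : Plane → ℝ}
    (hφ : ContDiff ℝ 1 φ) {b c : ℝ} (hb : 0 < b) (hc : c ≠ 0) :
    ∃ Φ : ℕ → ℝ → L2 Ω, (∀ k, MemLp (Φ k) 2) ∧
      (∀ k, ∫ η, ‖Φ k η‖ ^ 2 = volume.real Ω * |c|⁻¹) ∧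
      ∀ k (p : L2 Ω) (u : Plane → ℂ), p =ᵐ[volume.restrict Ω] u → frameEnergy (Φ k) p =
        ∫ η, ‖∫ x in Ω, (starRingEnd ℂ) (gaugedLandauFn φ b c k η x) * u x‖ ^ 2 := by
  refine ⟨fun k η => (memLp_gaugedLandauFn hfin hφ hb c k η).toLp _, ?_⟩
  have hn : ∀ k η, ‖(memLp_gaugedLandauFn hfin hφ hb c k η).toLp _‖ ^ 2 =
      ∫ x in Ω, hermiteFn b k (x 0 - c * η) ^ 2 := fun k η => by
    rw [norm_sq_toLp]
    simp only [norm_gaugedLandauFn, sq_abs]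
  refine ⟨fun k => ?_, fun k => ?_, fun k p u hp => ?_⟩
  · rw [memLp_two_iff_integrable_sq_norm
      (continuous_toLp_gaugedLandauFn hfin hφ hb c k).aestronglyMeasurable]
    simp only [hn]
    exact (integral_integral_sq_hermiteFn hfin hb hc k).1
  · simp only [hn]
    exact (integral_integral_sq_hermiteFn hfin hb hc k).2
  · refine integral_congr_ae (.of_forall fun η => ?_)
    simp only
    rw [L2.inner_def]
    congr 2
    refine integral_congr_ae ?_
    filter_upwards [hp, (memLp_gaugedLandauFn hfin hφ hb c k η).coeFn_toLp] with x h1 h2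
    rw [h1, h2, RCLike.inner_apply, mul_comm]

end LandauFrame

/-! ### The frame inequality on the form domain -/

section KeyInequality

open MagneticPlane

/-- The lower bound for the magnetic energy in terms of the weights of the Landau levels. -/
theorem energy_ge_of_hasCompactSupport {A : Plane → Plane} (hA : ContDiff ℝ 1 A) {B₀ b σ : ℝ}
    (hb : 0 < b) (hσ : σ ^ 2 = 1) (hB : B₀ = σ * b) (hAB : ∀ x, magneticField A x = B₀)
    {φ : Plane → ℝ} (hφ : ContDiff ℝ 1 φ) (h0 : ∀ x, partialDeriv 0 φ x = A x 0)
    (h1 : ∀ x, partialDeriv 1 φ x = A x 1 - B₀ * x 0) {u : Plane → ℂ} (hu : ContDiff ℝ 2 u)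
    (huc : HasCompactSupport u) (n : ℕ) :
    (2 * n + 1) * b * ∫ x, ‖u x‖ ^ 2 ≤ ∑ k, (∫ x, ‖magneticGradient A k u x‖ ^ 2) +
      ∑ k ∈ Finset.range n, 2 * b * (n - k : ℝ) * ∫ η,
        ‖∫ x, (starRingEnd ℂ) (gaugedLandauFn φ b (2 * Real.pi * σ / b) k η x) * u x‖ ^ 2 := by
  have hu1 : ContDiff ℝ 1 u := hu.of_le (by norm_num)
  set q : ℕ → ℝ := fun k => ∫ η,
    ‖∫ x, (starRingEnd ℂ) (gaugedLandauFn φ b (2 * Real.pi * σ / b) k η x) * u x‖ ^ 2 with hq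
  have hq0 : ∀ k, 0 ≤ q k := fun k => integral_nonneg fun _ => by positivity
  have s1 : HasSum q (∫ x, ‖u x‖ ^ 2) :=
    hasSum_integral_gaugedLandauFn hφ.continuous hb _ hu.continuous huc
  have hlc : Continuous (lowering A σ u) :=
    (continuous_const.mul (continuous_magneticGradient hA.continuous 0 hu1)).add
      (continuous_const.mul (continuous_magneticGradient hA.continuous 1 hu1))
  have hls : HasCompactSupport (lowering A σ u) :=
    (huc.magneticGradient A 0).mul_left.add (huc.magneticGradient A 1).mul_left
  have s2 := hasSum_integral_gaugedLandauFn hφ.continuous hb (2 * Real.pi * σ / b) hlc hls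
  have hr : ∀ k : ℕ, ∫ η, ‖∫ x, (starRingEnd ℂ)
      (gaugedLandauFn φ b (2 * Real.pi * σ / b) k η x) * lowering A σ u x‖ ^ 2 =
        2 * b * ((k + 1 : ℕ) : ℝ) * q (k + 1) := by
    intro k
    rw [hq, ← integral_const_mul]
    refine integral_congr_ae (.of_forall fun η => ?_)
    simp only
    rw [integral_conj_gaugedLandauFn_mul_lowering hA.continuous hφ hb hσ hB h0 h1 k η hu1 huc,
      norm_mul, mul_pow, Complex.norm_real, Real.norm_eq_abs, sq_abs, Real.sq_sqrt (by positivity)]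
    push_cast
    rfl
  simp only [hr] at s2
  -- The index is shifted by one; the added term k = 0 has weight zero.
  have s3 : HasSum (fun k : ℕ => 2 * b * (k : ℝ) * q k) (∫ x, ‖lowering A σ u x‖ ^ 2) := by
    rw [← hasSum_nat_add_iff' 1]
    simpa using s2
  have s4 : HasSum (fun k : ℕ => 2 * b * (k : ℝ) * q k - 2 * b * n * q k)
      ((∫ x, ‖lowering A σ u x‖ ^ 2) - 2 * b * n * ∫ x, ‖u x‖ ^ 2) :=
    s3.sub (s1.mul_left _)
  -- The terms 2b(k - n) q_k with k ≥ n are nonnegative, so the whole sum is at least its part with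
  -- k < n.
  have s5 := sum_le_hasSum (Finset.range n) (fun k hk => ?_) s4
  · rw [integral_sq_norm_magneticGradient hA hσ hB hAB hu huc]
    have s6 : ∑ k ∈ Finset.range n, (2 * b * (k : ℝ) * q k - 2 * b * n * q k) =
        - ∑ k ∈ Finset.range n, 2 * b * (n - k : ℝ) * q k := by
      rw [← Finset.sum_neg_distrib]
      exact Finset.sum_congr rfl fun k _ => by ring
    rw [s6] at s5
    linarith
  · have : (n : ℝ) ≤ k := by exact_mod_cast not_lt.1 (Finset.mem_range.not.1 hk)
    have h2 : 2 * b * (k : ℝ) * q k - 2 * b * n * q k = 2 * b * (k - n) * q k := by ring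
    rw [h2]
    exact mul_nonneg (mul_nonneg (by linarith) (by linarith)) (hq0 k)

theorem magneticGradient_eq_zero_of_notMem_tsupport (A : Plane → Plane) (k : Fin 2)
    {u : Plane → ℂ} {x : Plane} (hx : x ∉ tsupport u) : magneticGradient A k u x = 0 := by
  have h1 : fderiv ℝ u x = 0 := fderiv_of_notMem_tsupport (𝕜 := ℝ) hx
  rw [magneticGradient, partialDeriv, h1, image_eq_zero_of_notMem_tsupport hx]
  simp

theorem norm_sq_L2_eq {Ω : Set Plane} {p : L2 Ω} {u : Plane → ℂ}
    (hp : p =ᵐ[volume.restrict Ω] u) (hu : ∀ x ∉ Ω, u x = 0) : ‖p‖ ^ 2 = ∫ x, ‖u x‖ ^ 2 := by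
  calc ‖p‖ ^ 2 = ∫ x in Ω, ‖p x‖ ^ 2 := by
        rw [← norm_sq_toLp (Lp.memLp p), Lp.toLp_coeFn]
    _ = ∫ x in Ω, ‖u x‖ ^ 2 := integral_congr_ae (hp.mono fun x hx => by simp only [hx])
    _ = ∫ x, ‖u x‖ ^ 2 := setIntegral_eq_integral_of_forall_compl_eq_zero fun x hx => by
        rw [hu x hx, norm_zero, zero_pow two_ne_zero]

/-- There is a frame controlling the form of the magnetic Dirichlet Laplacian. -/
theorem exists_frame_formGraph {Ω : Set Plane} (hfin : volume Ω < ⊤) {B₀ b σ : ℝ} (hb : 0 < b)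
    (hσ : σ ^ 2 = 1) (hB : B₀ = σ * b) {A : Plane → Plane} (hA : ContDiff ℝ 1 A)
    (hAB : ∀ x, magneticField A x = B₀) :
    ∃ Φ : ℕ → ℝ → L2 Ω, (∀ k, MemLp (Φ k) 2) ∧
      (∀ k, ∫ η, ‖Φ k η‖ ^ 2 ≤ b * volume.real Ω / (2 * Real.pi)) ∧
      ∀ n : ℕ, ∀ p ∈ formGraph Ω A, (2 * n + 1) * b * ‖p.1‖ ^ 2 ≤ ∑ k, ‖p.2 k‖ ^ 2 +
        ∑ k ∈ Finset.range n, 2 * b * (n - k : ℝ) * frameEnergy (Φ k) p.1 := by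
  obtain ⟨φ, hφ, hφA⟩ := exists_gauge hA hAB
  have hσ1 : |σ| = 1 := by
    rw [← sq_eq_sq₀ (abs_nonneg _) zero_le_one, sq_abs, hσ, one_pow]
  have hc : 2 * Real.pi * σ / b ≠ 0 := by
    have : σ ≠ 0 := fun h => by simp [h] at hσ
    have := Real.pi_ne_zero
    positivity
  obtain ⟨Φ, hΦ, hΦn, hΦe⟩ := exists_landauFrame hfin hφ hb hc
  refine ⟨Φ, hΦ, fun k => ?_, fun n => ?_⟩
  · rw [hΦn, abs_div, abs_mul, hσ1, abs_of_pos hb, abs_of_pos Real.two_pi_pos]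
    apply le_of_eq
    field_simp
  -- The inequality is a closed condition on (u, g), so it suffices to check it on the graph over
  -- test functions.
  · have hclosed : IsClosed {p : L2 Ω × (Fin 2 → L2 Ω) | (2 * n + 1) * b * ‖p.1‖ ^ 2 ≤
        ∑ k, ‖p.2 k‖ ^ 2 +
          ∑ k ∈ Finset.range n, 2 * b * (n - k : ℝ) * frameEnergy (Φ k) p.1} := by
      have := fun k => (continuous_frameEnergy (hΦ k))
      exact isClosed_le (by fun_prop) (by fun_prop)
    refine fun p hp => closure_minimal (fun p hp => ?_) hclosed hp
    obtain ⟨u, hu, hp1, hp2⟩ := hp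
    have hu0 : ∀ x ∉ Ω, u x = 0 := fun x hx =>
      image_eq_zero_of_notMem_tsupport fun h => hx (hu.subset h)
    have key := energy_ge_of_hasCompactSupport hA hb hσ hB hAB hφ (fun x => (hφA x).1)
      (fun x => (hφA x).2) (by exact_mod_cast contDiff_infty.1 hu.smooth 2) hu.compact n
    have e1 : ∀ k, ‖p.2 k‖ ^ 2 = ∫ x, ‖magneticGradient A k u x‖ ^ 2 := fun k =>
      norm_sq_L2_eq (hp2 k) fun x hx =>
        magneticGradient_eq_zero_of_notMem_tsupport A k fun h => hx (hu.subset h)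
    have e2 : ∀ k η, ∫ x in Ω, (starRingEnd ℂ)
        (gaugedLandauFn φ b (2 * Real.pi * σ / b) k η x) * u x =
          ∫ x, (starRingEnd ℂ) (gaugedLandauFn φ b (2 * Real.pi * σ / b) k η x) * u x :=
      fun k η => setIntegral_eq_integral_of_forall_compl_eq_zero fun x hx => by
        rw [hu0 x hx, mul_zero]
    simp only [Set.mem_ofPred_eq, norm_sq_L2_eq hp1 hu0, e1, hΦe _ _ u hp1, e2]
    exact key

end KeyInequality

/-! ### Density of the form domain and infinite dimension of L² -/

section Dirichlet

open MagneticPlane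

theorem exists_mem_testGraph {Ω : Set Plane} {A : Plane → Plane} (hA : Continuous A)
    {u : Plane → ℂ} (hu : IsTestFunction Ω u) :
    ∃ p ∈ testGraph Ω A, p.1 =ᵐ[volume.restrict Ω] u := by
  have hu1 : ContDiff ℝ 1 u := by exact_mod_cast contDiff_infty.1 hu.smooth 1
  have h1 : MemLp u 2 (volume.restrict Ω) := hu1.continuous.memLp_of_hasCompactSupport hu.compact
  have h2 : ∀ k, MemLp (magneticGradient A k u) 2 (volume.restrict Ω) := fun k =>
    (continuous_magneticGradient hA k hu1).memLp_of_hasCompactSupport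
      (hu.compact.magneticGradient A k)
  exact ⟨(h1.toLp u, fun k => (h2 k).toLp _), ⟨u, hu, h1.coeFn_toLp, fun k => (h2 k).coeFn_toLp⟩,
    h1.coeFn_toLp⟩

/-- The form domain is dense. -/
theorem eq_zero_of_forall_formGraph_inner {Ω : Set Plane} (hΩ : IsOpen Ω) (hfin : volume Ω < ⊤)
    {A : Plane → Plane} (hA : Continuous A) {f : L2 Ω}
    (h : ∀ p ∈ formGraph Ω A, inner ℂ p.1 f = 0) : f = 0 := by
  have : IsFiniteMeasure (volume.restrict Ω) := ⟨by simpa using hfin⟩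
  have hloc : LocallyIntegrableOn f Ω volume := by
    have h1 : IntegrableOn f Ω volume := (Lp.memLp f).integrable (by norm_num)
    exact h1.locallyIntegrableOn
  rw [Lp.eq_zero_iff_ae_eq_zero]
  refine (ae_restrict_iff' hΩ.measurableSet).2
    (hΩ.ae_eq_zero_of_integral_contDiff_smul_eq_zero hloc fun g hg hgc hgs => ?_)
  have hu : IsTestFunction Ω fun x => (g x : ℂ) :=
    { smooth := Complex.ofRealCLM.contDiff.comp hg
      compact := hgc.comp_left (g := fun r : ℝ => (r : ℂ)) Complex.ofReal_zero
      subset := (tsupport_comp_subset (g := fun r : ℝ => (r : ℂ)) Complex.ofReal_zero g).trans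
        hgs }
  obtain ⟨p, hp, hpu⟩ := exists_mem_testGraph hA hu
  have h1 := h p ((testGraph Ω A).le_topologicalClosure hp)
  rw [L2.inner_def] at h1
  rw [← setIntegral_eq_integral_of_forall_compl_eq_zero (s := Ω), ← h1]
  · refine integral_congr_ae ?_
    filter_upwards [hpu] with x hx
    rw [hx, RCLike.inner_apply, Complex.conj_ofReal, Complex.real_smul, mul_comm]
  · intro x hx
    rw [image_eq_zero_of_notMem_tsupport fun h => hx (hgs h), zero_smul]

theorem not_finiteDimensional_L2 {Ω : Set Plane} (hΩ : IsOpen Ω) (hne : Ω.Nonempty)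
    (hfin : volume Ω < ⊤) : ¬ FiniteDimensional ℂ (L2 Ω) := by
  intro hfd
  obtain ⟨x, hx⟩ := hne
  obtain ⟨t, htΩ, htc⟩ := (infinite_of_mem_nhds x (hΩ.mem_nhds hx)).exists_subset_card_eq
    (Module.finrank ℂ (L2 Ω) + 1)
  -- Disjoint neighbourhoods of arbitrarily many points of `Ω` have orthogonal, nonzero indicator
  -- functions.
  obtain ⟨U, hU, hUd⟩ := t.finite_toSet.t2_separation
  have hm : ∀ i : t, MeasurableSet (U i) := fun i => (hU i).2.measurableSet
  have : IsFiniteMeasure (volume.restrict Ω) := ⟨by simpa using hfin⟩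
  have hμ : ∀ i : t, volume.restrict Ω (U i) ≠ ⊤ := fun i => measure_ne_top _ _
  set v : t → L2 Ω := fun i => indicatorConstLp 2 (hm i) (hμ i) (1 : ℂ) with hv
  have hin : ∀ i j, inner ℂ (v i) (v j) = ((volume.restrict Ω).real (U i ∩ U j) : ℂ) := fun i j =>
    L2.inner_indicatorConstLp_one_indicatorConstLp_one (𝕜 := ℂ) (hm i) (hm j) (hμ i) (hμ j)
  have hli : LinearIndependent ℂ v := by
    refine linearIndependent_of_ne_zero_of_inner_eq_zero (fun i hi => ?_) fun i j hij => ?_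
    · have h1 := hin i i
      rw [hi, inner_zero_left, Set.inter_self, eq_comm, Complex.ofReal_eq_zero,
        measureReal_eq_zero_iff, Measure.restrict_apply (hm i)] at h1
      exact (((hU i).2.inter hΩ).measure_pos volume ⟨i, (hU i).1, htΩ i.2⟩).ne' h1
    · have : Disjoint (U i) (U j) := hUd i.2 j.2 (Subtype.coe_injective.ne hij)
      change inner ℂ (v i) (v j) = 0
      rw [hin, this.inter_eq]
      simp
  have := hli.fintype_card_le_finrank
  rw [Fintype.card_coe, htc] at this
  omega

end Dirichlet

/-! ### Choice of the level n and conclusion -/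

/-- The product m(1 - m) is symmetric under m ↦ 1 - m. For x = P take n = ⌊P⌋, so P - n = m. For x =
-P with P > 0 take n = ⌈P⌉ - 1, so P - n = 1 - m. -/
theorem exists_nat_mul_one_sub_eq {P x : ℝ} (hP : 0 ≤ P) (hx : x = P ∨ x = -P) :
    ∃ n : ℕ, (P - n) * (1 - (P - n)) = Int.fract x * (1 - Int.fract x) := by
  rcases hx with rfl | rfl
  · exact ⟨⌊x⌋₊, by rw [Int.fract, natCast_floor_eq_intCast_floor hP]⟩
  · rcases hP.eq_or_lt with rfl | hP
    · exact ⟨0, by simp⟩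
    · have h1 : 0 < ⌈P⌉₊ := Nat.ceil_pos.2 hP
      refine ⟨⌈P⌉₊ - 1, ?_⟩
      have h2 : Int.fract (-P) = ⌈P⌉₊ - P := by
        rw [Int.fract, Int.floor_neg, natCast_ceil_eq_intCast_ceil hP.le]
        push_cast
        ring
      rw [h2, Nat.cast_sub h1]
      push_cast
      ring

theorem mainTheorem7 (Ω : Set Plane) (hΩ : IsOpen Ω) (hne : Ω.Nonempty)
    (hfin : volume Ω < ⊤) (B₀ : ℝ) (hB : B₀ ≠ 0) (A : Plane → Plane) (hA : ContDiff ℝ 1 A)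
    (hAB : ∀ x, MagneticPlane.magneticField A x = B₀) :
    (∃ μ : ℕ → ℝ, MagneticPlane.IsEigenvalueSequence Ω A μ) ∧
    ∀ μ : ℕ → ℝ, MagneticPlane.IsEigenvalueSequence Ω A μ → ∀ (N : ℕ) (m : ℝ),
      m = Int.fract (2 * Real.pi * N / (B₀ * volume.real Ω)) →
      2 * Real.pi * (N : ℝ) ^ 2 / volume.real Ω
          + B₀ ^ 2 / (2 * Real.pi) * volume.real Ω * (m * (1 - m))
        ≤ ∑ j ∈ Finset.range N, μ j := by
  obtain ⟨σ, hσ, hBσ⟩ : ∃ σ : ℝ, (σ = 1 ∨ σ = -1) ∧ B₀ = σ * |B₀| := by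
    rcases le_total 0 B₀ with h | h
    · exact ⟨1, .inl rfl, by rw [abs_of_nonneg h, one_mul]⟩
    · exact ⟨-1, .inr rfl, by rw [abs_of_nonpos h]; ring⟩
  have hb : 0 < |B₀| := abs_pos.2 hB
  have hσ2 : σ ^ 2 = 1 := by rcases hσ with rfl | rfl <;> norm_num
  have ha : 0 < volume.real Ω := ENNReal.toReal_pos (hΩ.measure_pos volume hne).ne' hfin.ne
  obtain ⟨Φ, hΦ, hΦC, hkey⟩ := exists_frame_formGraph hfin hb hσ2 hBσ hA hAB
  have hE : ∀ t u, u ∈ MagneticPlane.eigenspace Ω A t ↔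
      IsFormEigenvector (MagneticPlane.formGraph Ω A) t u := fun t u => Iff.rfl
  have hV : IsClosed (MagneticPlane.formGraph Ω A :
      Set (MagneticPlane.L2 Ω × (Fin 2 → MagneticPlane.L2 Ω))) :=
    (MagneticPlane.testGraph Ω A).isClosed_topologicalClosure
  constructor
  · obtain ⟨μ, hμ, hμE⟩ := exists_eigenvalue_sequence hE hΦ hb hΦC hkey hV
      (fun f => eq_zero_of_forall_formGraph_inner hΩ hfin hA.continuous)
      (not_finiteDimensional_L2 hΩ hne hfin)
    exact ⟨μ, hμ, hμE⟩
  · rintro μ hμ N m rfl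
    set a := volume.real Ω
    set b := |B₀|
    have hx : 2 * Real.pi * N / (B₀ * a) = 2 * Real.pi * N / (b * a) ∨
        2 * Real.pi * N / (B₀ * a) = -(2 * Real.pi * N / (b * a)) := by
      rw [hBσ]
      rcases hσ with rfl | rfl
      · left; rw [one_mul]
      · right; rw [neg_one_mul, neg_mul, div_neg]
    obtain ⟨n, hn⟩ := exists_nat_mul_one_sub_eq
      (P := 2 * Real.pi * N / (b * a)) (by positivity) hx
    rw [← hn]
    -- For C = ba/(2π) and P = N/C, the two sides agree by the identity (2n + 1)P - n(n + 1) = P² +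
    -- (P - n)(1 - (P - n)).
    refine le_of_eq_of_le ?_ (sum_eigenvalue_sequence_ge hE hΦ hb hΦC hkey hV hμ.multiplicity N n)
    rw [← sq_abs B₀]
    change 2 * Real.pi * (N : ℝ) ^ 2 / a + b ^ 2 / (2 * Real.pi) * a * _ = _
    have := Real.pi_ne_zero
    field_simp
    ring
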